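/- Let $\mathcal P_2(\mathbb R^d)$ be the set of Borel probability measures on $\mathbb R^d$ with finite second order moment. For $\mu,\nu\in\mathcal P_2(\mathbb R^d)$ let $\Pi(\mu,\nu)$ be the set of measures on $\mathbb R^d\times\mathbb R^d$ with first marginal $\mu$ and second marginal $\nu$, let $W_2^2(\mu,\nu)=\inf_{\pi\in\Pi(\mu,\nu)}\int|y-x|^2\,\pi(dx,dy)$, and let $\Pi^{opt}(\mu,\nu)$ be the set of couplings attaining this infimum. Fix an atomless probability space $(\Omega,\mathcal A,\mathbb P)$ and write $\mathcal L(X)$ for the law of $X$. The lift of $f:\mathcal P_2(\mathbb R^d)\to\mathbb R$ is the function $F(X)=f(\mathcal L(X))$ on $L^2(\Omega,\mathbb P;\mathbb R^d)$, and $f$ is called $L$-differentiable at $\mu$ if $F$ is Fréchet differentiable at some $X\in L^2(\Omega,\mathbb P;\mathbb R^d)$ with $\mathcal L(X)=\mu$. For $X,Y\in L^2(\Omega,\mathbb P;\mathbb R^d)$ let $$\mathbb W_2^2(X,Y)=\sup\Big\{\mathbb E[\psi(X)+\tilde\psi(Y)]:\ \psi\in L^1(\mathcal L(X)),\ \tilde\psi\in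 L^1(\mathcal L(Y)),\ \psi(x)+\tilde\psi(y)\le|x-y|^2\ \text{for all }x,y\in\mathbb R^d\Big\}.$$ **Theorem.** Let $\mu,\nu\in\mathcal P_2(\mathbb R^d)$. The map $\sigma\mapsto W_2^2(\sigma,\nu)$ is $L$-differentiable at $\mu$ if and only if there exists a measurable function $T:\mathbb R^d\to\mathbb R^d$ such that $\Pi^{opt}(\mu,\nu)=\{(I_d,T)\#\mu\}$. In that case, for all $X,Y\in L^2(\Omega,\mathbb P;\mathbb R^d)$ with $\mathcal L(X)=\mu$ and $\mathcal L(Y)=\nu$, the lift $Z\mapsto W_2^2(\mathcal L(Z),\nu)$ and the function $Z\mapsto\mathbb W_2^2(Z,Y)$ are Fréchet differentiable at $X$, and the Fréchet derivative of both (identified with an element of $L^2(\Omega,\mathbb P;\mathbb R^d)$ by the Riesz representation theorem) is $2(X-T(X))$. -/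

import Mathlib

open MeasureTheory
open scoped ENNReal

noncomputable section

namespace LionsW2

/-- The Euclidean space `ℝ^d`, with the Euclidean norm and inner product. -/
abbrev E (d : ℕ) : Type := EuclideanSpace ℝ (Fin d)

/-- `𝒫₂(ℝ^d)`: the Borel probability measures on `ℝ^d` with finite second order moment. -/
def P2 (d : ℕ) : Type :=
  {μ : Measure (E d) // IsProbabilityMeasure μ ∧ ∫⁻ x, ‖x‖ₑ ^ 2 ∂μ < ∞}

/-- The measure underlying an element of `𝒫₂(ℝ^d)`. -/
def P2.meas {d : ℕ} (μ : P2 d) : Measure (E d) := μ.1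

/-- `Π(μ,ν)`: the measures on `ℝ^d × ℝ^d` with first marginal `μ` and second marginal `ν`. -/
def couplings {d : ℕ} (μ ν : P2 d) : Set (Measure (E d × E d)) :=
  {π | π.map Prod.fst = μ.meas ∧ π.map Prod.snd = ν.meas}

/-- The quadratic transport cost `∫ |y - x|² π(dx,dy)`, with values in `[0,∞]`. -/
def cost {d : ℕ} (π : Measure (E d × E d)) : ℝ≥0∞ := ∫⁻ z, ‖z.2 - z.1‖ₑ ^ 2 ∂π

/-- The infimum of the quadratic cost over all couplings, with values in `[0,∞]`. -/
def minCost {d : ℕ} (μ ν : P2 d) : ℝ≥0∞ := ⨅ π ∈ couplings μ ν, cost π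

/-- The squared quadratic Wasserstein distance `W₂²(μ,ν)` as a real number. -/
def W2sq {d : ℕ} (μ ν : P2 d) : ℝ := (minCost μ ν).toReal

/-- `Π^opt(μ,ν)`: the set of optimal couplings. -/
def optCouplings {d : ℕ} (μ ν : P2 d) : Set (Measure (E d × E d)) :=
  {π | π ∈ couplings μ ν ∧ cost π = minCost μ ν}

/-- A measure is atomless if each measurable set of positive measure has a measurable subset of
strictly smaller positive measure. (On general measurable spaces this is stronger than the
vanishing of all singletons.) -/
def Atomless {Ω : Type*} [MeasurableSpace Ω] (P : Measure Ω) : Prop :=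
  ∀ A, MeasurableSet A → 0 < P A → ∃ B, MeasurableSet B ∧ B ⊆ A ∧ 0 < P B ∧ P B < P A

section Lift

variable {Ω : Type*} [MeasurableSpace Ω] (P : Measure Ω) [IsProbabilityMeasure P] {d : ℕ}

/-- The law of a square integrable random vector, an element of `𝒫₂(ℝ^d)`. -/
def law (X : Lp (E d) 2 P) : P2 d :=
  ⟨P.map X, Measure.isProbabilityMeasure_map (Lp.aestronglyMeasurable X).aemeasurable, by
    have h := lintegral_rpow_enorm_lt_top_of_eLpNorm_lt_top (two_ne_zero) (ENNReal.ofNat_ne_top)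
      (Lp.memLp X).2
    rw [lintegral_map' (by fun_prop) (Lp.aestronglyMeasurable X).aemeasurable]
    simpa using h⟩

/-- The lift `F(X) = f(ℒ(X))` of `f : 𝒫₂(ℝ^d) → ℝ` to `L²(Ω,P;ℝ^d)`. -/
def lift (f : P2 d → ℝ) (X : Lp (E d) 2 P) : ℝ := f (law P X)

/-- `f` is `L`-differentiable at `μ` if its lift is Fréchet differentiable at some `X ∼ μ`. -/
def LDifferentiableAt (f : P2 d → ℝ) (μ : P2 d) : Prop :=
  ∃ X : Lp (E d) 2 P, law P X = μ ∧ DifferentiableAt ℝ (lift P f) X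

/-- The values `𝔼[ψ(X) + ψ'(Y)]` of the dual transport problem: `ψ` and `ψ'` are integrable with
respect to the laws of `X` and `Y`, and `ψ(x) + ψ'(y) ≤ |x - y|²` for all `x, y`. -/
def dualValues (X Y : Lp (E d) 2 P) : Set ℝ :=
  {r | ∃ ψ ψ' : E d → ℝ, Integrable ψ (law P X).meas ∧ Integrable ψ' (law P Y).meas ∧
    (∀ x y, ψ x + ψ' y ≤ ‖x - y‖ ^ 2) ∧ r = ∫ ω, (ψ (X ω) + ψ' (Y ω)) ∂P}

/-- `𝕎₂²(X,Y)`, the supremum in the dual formulation. -/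
def WW2sq (X Y : Lp (E d) 2 P) : ℝ := sSup (dualValues P X Y)

end Lift

end LionsW2

end

open LionsW2

open Filter Topology Set

/-! Expanding the square, `W2sq (law P Z) ν` equals `‖Z‖ ^ 2 + ν.moment - 2 * maxCorr (law P Z) ν`,
so only the differentiability of the maximal correlation matters. On an atomless space it is the
support function, in L², of the set of random vectors with law `ν` (`Atomless.isSupportFunction`).
By Šmulian's criterion such a function has gradient `D` at `X` exactly when all almost maximizers of
`⟪X, ·⟫` in the set are close to `D`. Almost maximizers are the right notion: `X` may generate the
whole σ-algebra, and then an optimal coupling need not be the law of any pair `(X, Y)` on `Ω`; it is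
only approached (`Atomless.exists_pair`).

Differentiability implies a unique optimal map: glue two optimal couplings along the first marginal
and realise the result approximately as `(X, Y₁, Y₂)`. Both `Yᵢ` almost maximize, hence both are
close to `D`, so the two second variables coincide (`Atomless.glue_ae_eq`). Gluing a coupling to
itself shows that it is carried by a graph; gluing it to another one shows uniqueness.

Conversely, let the graph of `T` carry the only optimal coupling. The distance of `Y` to `T(X)` must
be controlled by the optimality gap of `(X, Y)`. Hahn–Banach applied to the directional derivative
of the dual value at the correlation reward gives this control (`exists_integral_le_add_gap`,
`exists_norm_sub_le`), and Šmulian's criterion gives the gradient `T(X)`.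

Kantorovich duality comes from the same source: a linear functional dominated by the dual value is
represented by a coupling, by the Riesz theorem and the tightness due to finite second moments. It
identifies `WW2sq` with `W2sq`. -/

namespace LionsW2

/-! ### Sierpiński's theorem and uniform variables on atomless spaces. -/

section Atomless

variable {Ω : Type*} [MeasurableSpace Ω]

theorem Atomless.restrict {P : Measure Ω} (h : Atomless P) {A : Set Ω} (hA : MeasurableSet A) :
    Atomless (P.restrict A) := by
  intro B hB hpos
  rw [Measure.restrict_apply hB] at hpos
  obtain ⟨C, hC, hCB, h0, hlt⟩ := h (B ∩ A) (hB.inter hA) hpos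
  have hCA : C ∩ A = C := inter_eq_left.2 (hCB.trans inter_subset_right)
  refine ⟨C, hC, hCB.trans inter_subset_left, ?_, ?_⟩
  · rwa [Measure.restrict_apply hC, hCA]
  · rwa [Measure.restrict_apply hC, hCA, Measure.restrict_apply hB]

/-- A measurable set is strictly below another one if it is contained in it and has a strictly
smaller measure. -/
def StrictSub (μ : Measure Ω) (A B : {A : Set Ω // MeasurableSet A}) : Prop :=
  A.1 ⊆ B.1 ∧ μ A.1 < μ B.1

theorem StrictSub.mem_of_isMaxChain {μ : Measure Ω} {C : Set {A : Set Ω // MeasurableSet A}}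
    (hC : IsMaxChain (StrictSub μ) C) (A : {A : Set Ω // MeasurableSet A})
    (h : ∀ B ∈ C, A = B ∨ StrictSub μ A B ∨ StrictSub μ B A) : A ∈ C := by
  have h1 : IsChain (StrictSub μ) (insert A C) :=
    hC.1.insert fun b hb hne => (h b hb).resolve_left hne
  rw [hC.2 h1 (subset_insert _ _)]
  exact mem_insert _ _

/-- The measure increases strictly along the chain, so comparing measures decides which of two
members is the smaller. -/
theorem StrictSub.subset_of_le {μ : Measure Ω} {C : Set {A : Set Ω // MeasurableSet A}}
    (hC : IsChain (StrictSub μ) C) {A B : {A : Set Ω // MeasurableSet A}} (hA : A ∈ C)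
    (hB : B ∈ C) (h : μ A.1 ≤ μ B.1) : A.1 ⊆ B.1 := by
  by_cases hAB : A = B
  · rw [hAB]
  · rcases hC hA hB hAB with h1 | h1
    · exact h1.1
    · exact absurd h1.2 (not_lt.2 h)

/-- A maximal chain contains sets of all possible measures (Sierpiński). -/
theorem Atomless.exists_mem_isMaxChain {μ : Measure Ω} [IsFiniteMeasure μ] (h : Atomless μ)
    {C : Set {A : Set Ω // MeasurableSet A}} (hC : IsMaxChain (StrictSub μ) C) {t : ℝ≥0∞}
    (ht : t ≤ μ univ) : ∃ A ∈ C, μ A.1 = t := by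
  by_contra! hne
  -- If `t` is missed, the members of measure below `t` have a least upper bound: the largest of
  -- them if there is one, otherwise the union of a sequence whose measures tend to the supremum.
  -- Inserting `0`, realised by `∅`, covers the case of no such member. `hupp` is the mirror image.
  have hlow : ∃ A : {A : Set Ω // MeasurableSet A}, μ A.1 ≤ t ∧
      (∀ B ∈ C, μ B.1 < t → A = B ∨ StrictSub μ B A) ∧ (∀ B ∈ C, t < μ B.1 → A.1 ⊆ B.1) := by
    set S : Set ℝ≥0∞ := insert 0 {x | ∃ B ∈ C, μ B.1 = x ∧ x < t} with hS
    by_cases hatt : ∃ B ∈ C, μ B.1 = sSup S ∧ μ B.1 < t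
    · obtain ⟨A, hA, hAS, hAt⟩ := hatt
      refine ⟨A, hAt.le, fun B hB hBt => ?_, fun B hB hBt => ?_⟩
      · by_cases hAB : A = B
        · exact Or.inl hAB
        · refine Or.inr ((hC.1 hB hA (Ne.symm hAB)).resolve_right fun h1 => ?_)
          exact absurd h1.2 (not_lt.2 (hAS ▸ le_sSup (mem_insert_of_mem _ ⟨B, hB, rfl, hBt⟩)))
      · exact StrictSub.subset_of_le hC.1 hA hB (hAt.trans hBt).le
    · push Not at hatt
      obtain ⟨u, -, hu, huS⟩ := exists_seq_tendsto_sSup (S := S) ⟨0, mem_insert _ _⟩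
        (OrderTop.bddAbove _)
      have hex : ∀ n, ∃ A : {A : Set Ω // MeasurableSet A}, μ A.1 = u n ∧
          ((A.1 = ∅) ∨ (A ∈ C ∧ μ A.1 < t)) := by
        intro n
        rcases huS n with h0 | ⟨B, hB, hBu, hBt⟩
        · exact ⟨⟨∅, MeasurableSet.empty⟩, by simp [h0], Or.inl rfl⟩
        · exact ⟨B, hBu, Or.inr ⟨hB, hBu ▸ hBt⟩⟩
      choose A hAu hA using hex
      have hsup : ∀ n, ∀ B ∈ C, μ (A n).1 ≤ μ B.1 → (A n).1 ⊆ B.1 := by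
        intro n B hB hle
        rcases hA n with h1 | h1
        · simp [h1]
        · exact StrictSub.subset_of_le hC.1 h1.1 hB hle
      have hAt : ∀ n, μ (A n).1 ≤ t := by
        intro n
        rcases hA n with h1 | h1
        · simp [h1]
        · exact h1.2.le
      have hsub : ∀ B ∈ C, μ B.1 < t → ∃ n, B.1 ⊆ (A n).1 ∧ μ B.1 < μ (A n).1 := by
        intro B hB hBt
        have hlt : μ B.1 < sSup S := by
          refine lt_of_le_of_ne (le_sSup (mem_insert_of_mem _ ⟨B, hB, rfl, hBt⟩)) fun h1 => ?_
          exact absurd hBt (not_lt.2 (hatt B hB h1))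
        obtain ⟨n, hn⟩ := (hu.eventually (lt_mem_nhds hlt)).exists
        rw [← hAu] at hn
        refine ⟨n, ?_, hn⟩
        rcases hA n with h1 | h1
        · simp [h1] at hn
        · exact StrictSub.subset_of_le hC.1 hB h1.1 hn.le
      have hdir : Directed (· ⊆ ·) fun n => (A n).1 := by
        intro i j
        rcases hA i with h1 | h1
        · exact ⟨j, by simp [h1], subset_rfl⟩
        · rcases hA j with h2 | h2
          · exact ⟨i, subset_rfl, by simp [h2]⟩
          · rcases le_total (μ (A i).1) (μ (A j).1) with h3 | h3
            · exact ⟨j, hsup i _ h2.1 h3, subset_rfl⟩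
            · exact ⟨i, subset_rfl, hsup j _ h1.1 h3⟩
      refine ⟨⟨⋃ n, (A n).1, MeasurableSet.iUnion fun n => (A n).2⟩, ?_, ?_, ?_⟩
      · rw [hdir.measure_iUnion]
        exact iSup_le hAt
      · intro B hB hBt
        obtain ⟨n, h1, h2⟩ := hsub B hB hBt
        exact Or.inr ⟨h1.trans (subset_iUnion (fun n => (A n).1) n),
          h2.trans_le (measure_mono (subset_iUnion (fun n => (A n).1) n))⟩
      · intro B hB hBt
        exact iUnion_subset fun n => hsup n B hB ((hAt n).trans hBt.le)
  have hupp : ∃ A : {A : Set Ω // MeasurableSet A}, t ≤ μ A.1 ∧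
      (∀ B ∈ C, t < μ B.1 → A = B ∨ StrictSub μ A B) ∧ (∀ B ∈ C, μ B.1 < t → B.1 ⊆ A.1) := by
    set S : Set ℝ≥0∞ := insert (μ univ) {x | ∃ B ∈ C, μ B.1 = x ∧ t < x} with hS
    by_cases hatt : ∃ B ∈ C, μ B.1 = sInf S ∧ t < μ B.1
    · obtain ⟨A, hA, hAS, hAt⟩ := hatt
      refine ⟨A, hAt.le, fun B hB hBt => ?_, fun B hB hBt => ?_⟩
      · by_cases hAB : A = B
        · exact Or.inl hAB
        · refine Or.inr ((hC.1 hA hB hAB).resolve_right fun h1 => ?_)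
          exact absurd h1.2 (not_lt.2 (hAS ▸ sInf_le (mem_insert_of_mem _ ⟨B, hB, rfl, hBt⟩)))
      · exact StrictSub.subset_of_le hC.1 hB hA (hBt.trans hAt).le
    · push Not at hatt
      obtain ⟨u, -, hu, huS⟩ := exists_seq_tendsto_sInf (S := S) ⟨μ univ, mem_insert _ _⟩
        (OrderBot.bddBelow _)
      have hex : ∀ n, ∃ A : {A : Set Ω // MeasurableSet A}, μ A.1 = u n ∧
          ((A.1 = univ) ∨ (A ∈ C ∧ t < μ A.1)) := by
        intro n
        rcases huS n with h0 | ⟨B, hB, hBu, hBt⟩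
        · exact ⟨⟨univ, MeasurableSet.univ⟩, by simp [h0], Or.inl rfl⟩
        · exact ⟨B, hBu, Or.inr ⟨hB, hBu ▸ hBt⟩⟩
      choose A hAu hA using hex
      have hsup : ∀ n, ∀ B ∈ C, μ B.1 ≤ μ (A n).1 → B.1 ⊆ (A n).1 := by
        intro n B hB hle
        rcases hA n with h1 | h1
        · simp [h1]
        · exact StrictSub.subset_of_le hC.1 hB h1.1 hle
      have hAt : ∀ n, t ≤ μ (A n).1 := by
        intro n
        rcases hA n with h1 | h1
        · simpa [h1] using ht
        · exact h1.2.le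
      have hsub : ∀ B ∈ C, t < μ B.1 → ∃ n, (A n).1 ⊆ B.1 ∧ μ (A n).1 < μ B.1 := by
        intro B hB hBt
        have hlt : sInf S < μ B.1 := by
          refine lt_of_le_of_ne (sInf_le (mem_insert_of_mem _ ⟨B, hB, rfl, hBt⟩)) fun h1 => ?_
          exact absurd hBt (not_lt.2 (hatt B hB h1.symm))
        obtain ⟨n, hn⟩ := (hu.eventually (gt_mem_nhds hlt)).exists
        rw [← hAu] at hn
        refine ⟨n, ?_, hn⟩
        rcases hA n with h1 | h1
        · rw [h1] at hn
          exact absurd hn (not_lt.2 (measure_mono (subset_univ _)))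
        · exact StrictSub.subset_of_le hC.1 h1.1 hB hn.le
      have hdir : Directed (· ⊇ ·) fun n => (A n).1 := by
        intro i j
        rcases hA i with h1 | h1
        · exact ⟨j, by simp [h1], subset_rfl⟩
        · rcases hA j with h2 | h2
          · exact ⟨i, subset_rfl, by simp [h2]⟩
          · rcases le_total (μ (A i).1) (μ (A j).1) with h3 | h3
            · exact ⟨i, subset_rfl, hsup j _ h1.1 h3⟩
            · exact ⟨j, hsup i _ h2.1 h3, subset_rfl⟩
      refine ⟨⟨⋂ n, (A n).1, MeasurableSet.iInter fun n => (A n).2⟩, ?_, ?_, ?_⟩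
      · rw [hdir.measure_iInter (fun n => (A n).2.nullMeasurableSet) ⟨0, measure_ne_top _ _⟩]
        exact le_iInf hAt
      · intro B hB hBt
        obtain ⟨n, h1, h2⟩ := hsub B hB hBt
        exact Or.inr ⟨(iInter_subset (fun n => (A n).1) n).trans h1,
          (measure_mono (iInter_subset (fun n => (A n).1) n)).trans_lt h2⟩
      · intro B hB hBt
        exact subset_iInter fun n => hsup n B hB (hBt.le.trans (hAt n))
  obtain ⟨A, hAt, hAl, hAu⟩ := hlow
  obtain ⟨A', hAt', hAu', hAl'⟩ := hupp
  have key : ∀ D : {A : Set Ω // MeasurableSet A}, (∀ B ∈ C, μ B.1 < t → D = B ∨ StrictSub μ B D) →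
      (∀ B ∈ C, t < μ B.1 → D = B ∨ StrictSub μ D B) → D ∈ C := by
    intro D h1 h2
    refine StrictSub.mem_of_isMaxChain hC D fun B hB => ?_
    rcases lt_or_gt_of_ne (hne B hB) with h3 | h3
    · rcases h1 B hB h3 with h4 | h4
      · exact Or.inl h4
      · exact Or.inr (Or.inr h4)
    · rcases h2 B hB h3 with h4 | h4
      · exact Or.inl h4
      · exact Or.inr (Or.inl h4)
  have hlt : μ A.1 < t := by
    refine lt_of_le_of_ne hAt fun h1 => hne A (key A hAl fun B hB hBt => Or.inr ⟨hAu B hB hBt, ?_⟩) h1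
    rwa [h1]
  have hlt' : t < μ A'.1 := by
    refine lt_of_le_of_ne hAt' fun h1 =>
      hne A' (key A' (fun B hB hBt => Or.inr ⟨hAl' B hB hBt, ?_⟩) hAu') h1.symm
    rwa [← h1]
  have hsubset : A.1 ⊆ A'.1 := by
    by_cases hA : A ∈ C
    · exact hAl' A hA hlt
    by_cases hA' : A' ∈ C
    · exact hAu A' hA' hlt'
    exfalso
    refine hA (key A hAl fun B hB hBt => Or.inr ⟨hAu B hB hBt, hlt.trans hBt⟩)
  have hdiff : 0 < μ (A'.1 \ A.1) := by
    rw [measure_sdiff hsubset A.2.nullMeasurableSet (measure_ne_top _ _)]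
    exact tsub_pos_of_lt (hlt.trans hlt')
  -- The gap between `A` and `A'` has positive measure and is split by atomlessness. The
  -- intermediate set `A ∪ D` is comparable with the whole chain, hence belongs to it, which
  -- contradicts the extremality of `A` or of `A'`.
  obtain ⟨D, hD, hDsub, hD0, hDlt⟩ := h _ (A'.2.diff A.2) hdiff
  have hdisj : Disjoint A.1 D := disjoint_of_subset_right hDsub disjoint_sdiff_right
  have hμ : μ (A.1 ∪ D) = μ A.1 + μ D := measure_union hdisj hD
  have h1 : μ A.1 < μ (A.1 ∪ D) := by
    rw [hμ]
    exact ENNReal.lt_add_right (measure_ne_top _ _) hD0.ne'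
  have h2 : μ (A.1 ∪ D) < μ A'.1 := by
    rw [hμ, ← sdiff_union_of_subset hsubset, measure_union disjoint_sdiff_left A.2, add_comm]
    exact ENNReal.add_lt_add_right (measure_ne_top _ _) hDlt
  have hsub2 : A.1 ∪ D ⊆ A'.1 := union_subset hsubset (hDsub.trans sdiff_subset)
  have hmem : (⟨A.1 ∪ D, A.2.union hD⟩ : {A : Set Ω // MeasurableSet A}) ∈ C := by
    refine key _ (fun B hB hBt => Or.inr ?_) fun B hB hBt => Or.inr ?_
    · rcases hAl B hB hBt with h3 | h3
      · exact h3 ▸ ⟨subset_union_left, h1⟩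
      · exact ⟨h3.1.trans subset_union_left, h3.2.trans h1⟩
    · rcases hAu' B hB hBt with h3 | h3
      · exact h3 ▸ ⟨hsub2, h2⟩
      · exact ⟨hsub2.trans h3.1, h2.trans h3.2⟩
  rcases lt_or_gt_of_ne (hne _ hmem) with h3 | h3
  · rcases hAl _ hmem h3 with h4 | h4
    · exact h1.ne (congrArg (fun B => μ B.1) h4)
    · exact absurd h1 (not_lt.2 h4.2.le)
  · rcases hAu' _ hmem h3 with h4 | h4
    · exact h2.ne (congrArg (fun B => μ B.1) h4).symm
    · exact absurd h2 (not_lt.2 h4.2.le)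

open unitInterval in
/-- An atomless finite measure carries a uniformly distributed random variable. -/
theorem Atomless.exists_measurable_map_eq_volume {μ : Measure Ω} [IsFiniteMeasure μ]
    (h : Atomless μ) : ∃ U : Ω → I, Measurable U ∧ μ.map U = μ univ • volume := by
  have hC : IsMaxChain (StrictSub μ) (maxChain (StrictSub μ)) := maxChain_spec
  have hex : ∀ q : I, ∃ A ∈ maxChain (StrictSub μ), μ A.1 = ENNReal.ofReal q * μ univ := by
    intro q
    refine h.exists_mem_isMaxChain hC (mul_le_of_le_one_left zero_le ?_)
    exact ENNReal.ofReal_le_one.2 q.2.2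
  choose A hA hAμ using hex
  have hmono : ∀ q s : I, q ≤ s → (A q).1 ⊆ (A s).1 := by
    intro q s hqs
    refine StrictSub.subset_of_le hC.1 (hA q) (hA s) ?_
    rw [hAμ, hAμ]
    gcongr
  let D : ℕ → I := TopologicalSpace.denseSeq I
  classical
  -- `U ω` is the level at which `ω` enters the chain. A countable dense set of levels ensures
  -- measurability; the default `1` is the top of `I` and does not affect the infimum.
  let U : Ω → I := fun ω => ⨅ n, if ω ∈ (A (D n)).1 then D n else 1
  have hU : Measurable U := by
    refine Measurable.iInf fun n => ?_
    exact Measurable.ite (A (D n)).2 measurable_const measurable_const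
  have hlt : ∀ s ω, U ω < s ↔ ∃ n, D n < s ∧ ω ∈ (A (D n)).1 := by
    intro s ω
    simp only [U, iInf_lt_iff]
    refine exists_congr fun n => ?_
    split_ifs with h1
    · simp [h1]
    · simp [h1, not_lt.2 (le_one' : s ≤ 1)]
  have hmeas : ∀ s : I, μ (U ⁻¹' Iio s) = ENNReal.ofReal s * μ univ := by
    intro s
    apply le_antisymm
    · rw [← hAμ]
      refine measure_mono fun ω hω => ?_
      obtain ⟨n, hn, hω⟩ := (hlt s ω).1 hω
      exact hmono _ _ hn.le hω
    · have h1 : ∀ q : I, q < s → ENNReal.ofReal q * μ univ ≤ μ (U ⁻¹' Iio s) := by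
        intro q hq
        obtain ⟨n, hn⟩ := (TopologicalSpace.denseRange_denseSeq I).exists_mem_open isOpen_Ioo
          (nonempty_Ioo.2 hq)
        rw [← hAμ]
        exact measure_mono fun ω hω => (hlt s ω).2 ⟨n, hn.2, hmono _ _ hn.1.le hω⟩
      by_cases hs : s = 0
      · simp [hs]
      have : (𝓝[<] s).NeBot := by
        refine nhdsLT_neBot_of_exists_lt ⟨0, lt_of_le_of_ne s.2.1 fun h => hs h.symm⟩
      refine le_of_tendsto (x := 𝓝[<] s) (f := fun q : I => ENNReal.ofReal q * μ univ) ?_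
        (eventually_nhdsWithin_of_forall h1)
      refine ENNReal.Tendsto.mul_const ?_ (Or.inr (measure_ne_top _ _))
      exact ((ENNReal.continuous_ofReal.comp continuous_subtype_val).tendsto s).mono_left
        nhdsWithin_le_nhds
  refine ⟨U, hU, ?_⟩
  have : IsFiniteMeasure (μ.map U) := inferInstance
  refine Measure.ext_of_Ici _ _ fun s => ?_
  have h1 : U ⁻¹' Ici s = (U ⁻¹' Iio s)ᶜ := by ext; simp
  rw [Measure.map_apply hU measurableSet_Ici, h1,
    measure_compl (hU measurableSet_Iio) (measure_ne_top _ _), hmeas, Measure.smul_apply,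
    smul_eq_mul, unitInterval.volume_Ici, mul_comm _ (μ univ),
    ENNReal.ofReal_sub _ s.2.1, ENNReal.mul_sub (fun _ _ => measure_ne_top _ _)]
  simp

end Atomless

/-! ### Realising prescribed joint laws on an atomless space. -/

section Realization

open unitInterval ProbabilityTheory

variable {Ω : Type*} [MeasurableSpace Ω] {P : Measure Ω} [IsProbabilityMeasure P]

/-- An atomless probability space carries a uniform random variable which is independent of a given
discrete random variable. -/
theorem Atomless.exists_indep_uniform (hP : Atomless P) {c : Ω → ℕ} (hc : Measurable c) :
    ∃ U : Ω → I, Measurable U ∧ P.map (fun ω => (c ω, U ω)) = (P.map c).prod volume := by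
  have hm : ∀ n, MeasurableSet (c ⁻¹' {n}) := fun n => hc (measurableSet_singleton n)
  -- Each level set of `c` is itself atomless and carries its own uniform variable; pasting these
  -- makes the conditional law given `c` uniform.
  choose U hU hUm using fun n => (hP.restrict (hm n)).exists_measurable_map_eq_volume
  have hV : Measurable fun ω => U (c ω) ω :=
    (measurable_from_prod_countable_right (f := fun p : ℕ × Ω => U p.1 p.2) hU).comp
      (hc.prodMk measurable_id)
  refine ⟨fun ω => U (c ω) ω, hV, ?_⟩
  have := Measure.isProbabilityMeasure_map (μ := P) hc.aemeasurable
  refine (Measure.prod_eq fun s t hs ht => ?_).symm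
  rw [Measure.map_apply (hc.prodMk hV) (hs.prod ht), Measure.map_apply hc hs]
  have h1 : (fun ω => (c ω, U (c ω) ω)) ⁻¹' s ×ˢ t
      = ⋃ n : s, (c ⁻¹' {(n : ℕ)} ∩ U n ⁻¹' t) := by
    ext ω
    simp only [mem_preimage, mem_prod, mem_iUnion, mem_inter_iff, mem_singleton_iff]
    constructor
    · rintro ⟨h1, h2⟩
      exact ⟨⟨c ω, h1⟩, rfl, h2⟩
    · rintro ⟨⟨n, hn⟩, rfl, h2⟩
      exact ⟨hn, h2⟩
  have h2 : c ⁻¹' s = ⋃ n : s, c ⁻¹' {(n : ℕ)} := by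
    ext ω
    simp
  have hd : Pairwise (Function.onFun Disjoint fun n : s => c ⁻¹' {(n : ℕ)}) := by
    intro n m hnm
    refine Disjoint.preimage c ?_
    simpa using fun h : (n : ℕ) = m => hnm (Subtype.ext h)
  rw [h1, h2, measure_iUnion hd fun n => hm n, measure_iUnion _ fun n : s => (hm n).inter (hU n ht),
    ← ENNReal.tsum_mul_right]
  · refine tsum_congr fun n => ?_
    have h3 := congrArg (fun m => m t) (hUm n)
    simp only [Measure.map_apply (hU n) ht, Measure.restrict_apply (hU n ht),
      Measure.restrict_apply MeasurableSet.univ, univ_inter, Measure.smul_apply, smul_eq_mul] at h3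
    rw [inter_comm, h3]
  · exact fun n m hnm => (hd hnm).mono inter_subset_left inter_subset_left

/-- On an atomless probability space, a discrete random variable can be completed to a pair with
prescribed joint law. -/
theorem Atomless.exists_map_prodMk_eq (hP : Atomless P) {K : Type*} [MeasurableSpace K]
    [StandardBorelSpace K] [Nonempty K] {c : Ω → ℕ} (hc : Measurable c) (ρ : Measure (ℕ × K))
    [IsProbabilityMeasure ρ] (hρ : ρ.map Prod.fst = P.map c) :
    ∃ V : Ω → K, Measurable V ∧ P.map (fun ω => (c ω, V ω)) = ρ := by
  obtain ⟨U, hU, hUm⟩ := hP.exists_indep_uniform hc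
  obtain ⟨f, hf, hfm⟩ := ρ.condKernel.exists_measurable_map_eq_unitInterval
  refine ⟨fun ω => f (c ω) (U ω), hf.comp (hc.prodMk hU), ?_⟩
  have hg : Measurable fun p : ℕ × I => (p.1, f p.1 p.2) := measurable_fst.prodMk hf
  have h1 : P.map (fun ω => (c ω, f (c ω) (U ω)))
      = ((P.map c).prod volume).map fun p : ℕ × I => (p.1, f p.1 p.2) := by
    rw [← hUm, Measure.map_map hg (hc.prodMk hU)]
    rfl
  rw [h1, ← hρ]
  conv_rhs => rw [← ρ.disintegrate ρ.condKernel]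
  ext s hs
  rw [Measure.map_apply hg hs, Measure.prod_apply (hg hs), Measure.compProd_apply hs]
  refine lintegral_congr fun n => ?_
  rw [← hfm n, Measure.map_apply hf.of_uncurry_left (measurable_prodMk_left hs)]
  rfl

/-- On an atomless probability space, a random variable `X` can be completed to a pair whose law is
prescribed up to a small perturbation of `X`. -/
theorem Atomless.exists_map_prodMk_eq_approx (hP : Atomless P) {K : Type*} [MeasurableSpace K]
    [StandardBorelSpace K] [Nonempty K] {F : Type*} [MetricSpace F] [SecondCountableTopology F]
    [MeasurableSpace F] [BorelSpace F] {X : Ω → F} (hX : Measurable X) (ρ : Measure (F × K))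
    [IsProbabilityMeasure ρ] (hρ : ρ.map Prod.fst = P.map X) {ε : ℝ} (hε : 0 < ε) :
    ∃ c : F → F, Measurable c ∧ (∀ x, dist x (c x) ≤ ε) ∧ ∃ V : Ω → K, Measurable V ∧
      P.map (fun ω => (c (X ω), V ω)) = ρ.map (Prod.map c id) := by
  classical
  have hne : Nonempty F := ⟨X (nonempty_of_isProbabilityMeasure P).some⟩
  -- Independent randomness is available only relative to a discrete variable, so `X` is replaced by
  -- the first point of a dense sequence within `ε`.
  have hex : ∀ x : F, ∃ n, dist x (TopologicalSpace.denseSeq F n) < ε := fun x =>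
    (TopologicalSpace.denseRange_denseSeq F).exists_dist_lt x hε
  have hn : Measurable fun x => Nat.find (hex x) :=
    measurable_find hex fun n => measurableSet_lt (by fun_prop) measurable_const
  have hd : Measurable (TopologicalSpace.denseSeq F) := measurable_from_top
  have hρn : Measurable (Prod.map (fun x : F => Nat.find (hex x)) (id : K → K)) :=
    hn.prodMap measurable_id
  have := Measure.isProbabilityMeasure_map (μ := ρ) hρn.aemeasurable
  obtain ⟨V, hV, hVm⟩ := hP.exists_map_prodMk_eq (hn.comp hX)
    (ρ.map (Prod.map (fun x : F => Nat.find (hex x)) (id : K → K))) (by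
      rw [Measure.map_map measurable_fst hρn, ← Measure.map_map hn hX, ← hρ,
        Measure.map_map hn measurable_fst]
      rfl)
  refine ⟨fun x => TopologicalSpace.denseSeq F (Nat.find (hex x)), hd.comp hn,
    fun x => (Nat.find_spec (hex x)).le, V, hV, ?_⟩
  have h2 := congrArg (Measure.map (Prod.map (TopologicalSpace.denseSeq F) (id : K → K))) hVm
  rw [Measure.map_map (hd.prodMap measurable_id) ((hn.comp hX).prodMk hV),
    Measure.map_map (hd.prodMap measurable_id) hρn] at h2
  exact h2

end Realization

/-! ### Continuous cutoff functions. -/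

section Cutoff

variable {G : Type*} [NormedAddCommGroup G]

/-- A continuous cutoff function, equal to `1` on the ball of radius `n` and to `0` outside of the
ball of radius `n + 1`. -/
noncomputable def cutoff (n : ℕ) (z : G) : ℝ := max 0 (min 1 (n + 1 - ‖z‖))

theorem continuous_cutoff (n : ℕ) : Continuous (cutoff n : G → ℝ) := by
  unfold cutoff
  fun_prop

theorem cutoff_nonneg (n : ℕ) (z : G) : 0 ≤ cutoff n z := le_max_left _ _

theorem cutoff_le_one (n : ℕ) (z : G) : cutoff n z ≤ 1 := max_le zero_le_one (min_le_left _ _)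

theorem cutoff_eq_one {n : ℕ} {z : G} (h : ‖z‖ ≤ n) : cutoff n z = 1 := by
  unfold cutoff
  rw [min_eq_left (by linarith), max_eq_right zero_le_one]

theorem cutoff_eq_zero {n : ℕ} {z : G} (h : n + 1 ≤ ‖z‖) : cutoff n z = 0 := by
  unfold cutoff
  rw [max_eq_left ((min_le_right _ _).trans (by linarith))]

theorem hasCompactSupport_mul_cutoff [ProperSpace G] (f : G → ℝ) (n : ℕ) :
    HasCompactSupport fun z => f z * cutoff n z := by
  refine HasCompactSupport.intro (isCompact_closedBall (0 : G) (n + 1)) fun z hz => ?_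
  rw [cutoff_eq_zero, mul_zero]
  simpa using (not_le.1 (mt mem_closedBall_zero_iff.2 hz)).le

theorem tendsto_cutoff (z : G) : Tendsto (fun n => cutoff n z) atTop (𝓝 1) := by
  obtain ⟨n, hn⟩ := exists_nat_ge ‖z‖
  refine tendsto_const_nhds.congr' ?_
  filter_upwards [eventually_ge_atTop n] with m hm
  rw [cutoff_eq_one (hn.trans (by exact_mod_cast hm))]

end Cutoff

/-! ### Representing functionals on functions of quadratic growth by couplings. -/

section QuadraticGrowth

variable {F : Type*} [NormedAddCommGroup F]

/-- The functions on `F × F` of at most quadratic growth. -/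
def quadGrowth (F : Type*) [NormedAddCommGroup F] : Submodule ℝ (F × F → ℝ) where
  carrier := {f | ∃ C, ∀ z, |f z| ≤ C * (1 + ‖z.1‖ ^ 2 + ‖z.2‖ ^ 2)}
  add_mem' := by
    rintro f g ⟨C, hC⟩ ⟨D, hD⟩
    exact ⟨C + D, fun z => (abs_add_le _ _).trans (by linarith [hC z, hD z])⟩
  zero_mem' := ⟨0, fun z => by simp⟩
  smul_mem' := by
    rintro c f ⟨C, hC⟩
    refine ⟨|c| * C, fun z => ?_⟩
    rw [Pi.smul_apply, smul_eq_mul, abs_mul, mul_assoc]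
    exact mul_le_mul_of_nonneg_left (hC z) (abs_nonneg c)

theorem quadGrowth.mul_mem {f g : F × F → ℝ} (hf : f ∈ quadGrowth F) (hg : ∀ z, |g z| ≤ 1) :
    (fun z => f z * g z) ∈ quadGrowth F := by
  obtain ⟨C, hC⟩ := hf
  refine ⟨C, fun z => ?_⟩
  rw [abs_mul]
  exact (mul_le_of_le_one_right (abs_nonneg _) (hg z)).trans (hC z)

theorem quadGrowth.of_bounded {f : F × F → ℝ} {C : ℝ} (h : ∀ z, |f z| ≤ C) : f ∈ quadGrowth F := by
  refine ⟨C, fun z => (h z).trans ?_⟩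
  have hC : 0 ≤ C := (abs_nonneg _).trans (h z)
  nlinarith [mul_nonneg hC (sq_nonneg ‖z.1‖), mul_nonneg hC (sq_nonneg ‖z.2‖)]

theorem quadGrowth.of_hasCompactSupport {f : F × F → ℝ} (hf : Continuous f)
    (h : HasCompactSupport f) : f ∈ quadGrowth F := by
  obtain ⟨C, hC⟩ := hf.bounded_above_of_compact_support h
  exact quadGrowth.of_bounded hC

/-- A linear functional on the functions of quadratic growth is controlled by the marginals `μ` and
`ν` if it is dominated by the integrals of decoupled upper bounds. -/
def MarginalBound [MeasurableSpace F] (μ ν : Measure F) (q : quadGrowth F → ℝ) : Prop :=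
  ∀ (f : quadGrowth F) (φ ψ : F → ℝ), Integrable φ μ → Integrable ψ ν →
    (∀ x y, f.1 (x, y) ≤ φ x + ψ y) → q f ≤ ∫ x, φ x ∂μ + ∫ y, ψ y ∂ν

/-- The weight `1 + 2‖x‖²`, restricted to the complement of a ball. -/
noncomputable def tailWeight (n : ℕ) : F → ℝ :=
  indicator {x | (n : ℝ) ≤ ‖x‖} fun x => 1 + 2 * ‖x‖ ^ 2

theorem tailWeight_nonneg (n : ℕ) (x : F) : 0 ≤ tailWeight n x :=
  indicator_nonneg (fun x _ => by positivity) x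

theorem tailWeight_eq {n : ℕ} {x : F} (h : (n : ℝ) ≤ ‖x‖) : tailWeight n x = 1 + 2 * ‖x‖ ^ 2 :=
  indicator_of_mem (s := {x : F | (n : ℝ) ≤ ‖x‖}) h _

/-- Off the ball, the larger of the two norms exceeds `n` and twice its square dominates the sum of
squares. This decouples the tail into one function of each variable, as `MarginalBound` requires. -/
theorem weight_mul_one_sub_cutoff_le (n : ℕ) (z : F × F) :
    (1 + ‖z.1‖ ^ 2 + ‖z.2‖ ^ 2) * (1 - cutoff n z) ≤ tailWeight n z.1 + tailWeight n z.2 := by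
  by_cases hz : ‖z‖ ≤ n
  · rw [cutoff_eq_one hz, sub_self, mul_zero]
    exact add_nonneg (tailWeight_nonneg _ _) (tailWeight_nonneg _ _)
  · have h0 : (1 + ‖z.1‖ ^ 2 + ‖z.2‖ ^ 2) * (1 - cutoff n z) ≤ 1 + ‖z.1‖ ^ 2 + ‖z.2‖ ^ 2 :=
      mul_le_of_le_one_right (by positivity) (by linarith [cutoff_nonneg n z])
    rw [Prod.norm_def] at hz
    rcases le_total ‖z.1‖ ‖z.2‖ with h | h
    · rw [max_eq_right h] at hz
      rw [tailWeight_eq (not_le.1 hz).le]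
      nlinarith [tailWeight_nonneg n z.1, pow_le_pow_left₀ (norm_nonneg _) h 2]
    · rw [max_eq_left h] at hz
      rw [tailWeight_eq (not_le.1 hz).le]
      nlinarith [tailWeight_nonneg n z.2, pow_le_pow_left₀ (norm_nonneg _) h 2]

/-- The product of a function of quadratic growth with a cutoff. -/
noncomputable def cutoffMul (f : quadGrowth F) (n : ℕ) : quadGrowth F :=
  ⟨fun z => f.1 z * cutoff n z, quadGrowth.mul_mem f.2 fun z => by
    rw [abs_of_nonneg (cutoff_nonneg n z)]
    exact cutoff_le_one n z⟩

variable [MeasurableSpace F] {μ ν : Measure F}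

theorem MarginalBound.abs_le {ℓ : quadGrowth F →ₗ[ℝ] ℝ} (h : MarginalBound μ ν ℓ)
    (f : quadGrowth F) {φ ψ : F → ℝ} (hφ : Integrable φ μ) (hψ : Integrable ψ ν)
    (hf : ∀ x y, |f.1 (x, y)| ≤ φ x + ψ y) : |ℓ f| ≤ ∫ x, φ x ∂μ + ∫ y, ψ y ∂ν := by
  refine abs_le'.2 ⟨h f φ ψ hφ hψ fun x y => (le_abs_self _).trans (hf x y), ?_⟩
  rw [← map_neg]
  exact h (-f) φ ψ hφ hψ fun x y => (neg_le_abs _).trans (hf x y)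

theorem MarginalBound.nonneg {ℓ : quadGrowth F →ₗ[ℝ] ℝ} (h : MarginalBound μ ν ℓ)
    {f : quadGrowth F} (hf : ∀ z, 0 ≤ f.1 z) : 0 ≤ ℓ f := by
  have h1 := h (-f) (fun _ => 0) (fun _ => 0) (integrable_zero _ _ _) (integrable_zero _ _ _)
    fun x y => by simpa using hf (x, y)
  simpa using h1

variable [BorelSpace F] [IsProbabilityMeasure μ] [IsProbabilityMeasure ν]

theorem integrable_tailWeight (h : Integrable (fun x => ‖x‖ ^ 2) μ) (n : ℕ) :
    Integrable (tailWeight n) μ :=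
  ((integrable_const 1).add (h.const_mul 2)).indicator
    (measurableSet_le measurable_const measurable_norm)

theorem tendsto_integral_tailWeight (h : Integrable (fun x => ‖x‖ ^ 2) μ) :
    Tendsto (fun n => ∫ x, tailWeight n x ∂μ) atTop (𝓝 0) := by
  have h1 : Integrable (fun x => 1 + 2 * ‖x‖ ^ 2) μ := (integrable_const 1).add (h.const_mul 2)
  have h2 := tendsto_integral_of_dominated_convergence (μ := μ) (F := fun n => tailWeight n)
    (f := fun _ => (0 : ℝ)) _ (fun n => (integrable_tailWeight h n).1) h1 ?_ ?_
  · simpa using h2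
  · refine fun n => ae_of_all _ fun x => ?_
    rw [Real.norm_eq_abs, abs_of_nonneg (tailWeight_nonneg n x)]
    exact indicator_le_self' (fun x _ => by positivity) x
  · refine ae_of_all _ fun x => ?_
    obtain ⟨n, hn⟩ := exists_nat_gt ‖x‖
    refine tendsto_const_nhds.congr' ?_
    filter_upwards [eventually_ge_atTop n] with m hm
    refine (indicator_of_notMem (s := {x : F | (m : ℝ) ≤ ‖x‖}) ?_ _).symm
    simpa using hn.trans_le (by exact_mod_cast hm)

/-- Tightness: the truncation error is bounded by marginal tail integrals, which vanish because the
second moments are finite. Hence the Riesz measure of `ℓ` on compactly supported functions loses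
nothing at infinity. -/
theorem MarginalBound.tendsto_cutoffMul {ℓ : quadGrowth F →ₗ[ℝ] ℝ} (h : MarginalBound μ ν ℓ)
    (hμ : Integrable (fun x => ‖x‖ ^ 2) μ) (hν : Integrable (fun x => ‖x‖ ^ 2) ν)
    (f : quadGrowth F) : Tendsto (fun n => ℓ (cutoffMul f n)) atTop (𝓝 (ℓ f)) := by
  obtain ⟨C, hC⟩ := f.2
  have hC0 : 0 ≤ C := by
    have := (abs_nonneg _).trans (hC 0)
    simpa using this
  rw [tendsto_iff_dist_tendsto_zero]
  have hlim : Tendsto (fun n => C * ∫ x, tailWeight n x ∂μ + C * ∫ x, tailWeight n x ∂ν) atTop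
      (𝓝 0) := by
    simpa using ((tendsto_integral_tailWeight hμ).const_mul C).add
      ((tendsto_integral_tailWeight hν).const_mul C)
  refine squeeze_zero (fun _ => dist_nonneg) (fun n => ?_) hlim
  rw [dist_comm, Real.dist_eq, ← map_sub, ← integral_const_mul, ← integral_const_mul]
  refine h.abs_le _ ((integrable_tailWeight hμ n).const_mul C)
    ((integrable_tailWeight hν n).const_mul C) fun x y => ?_
  have h1 : (f - cutoffMul f n).1 (x, y) = f.1 (x, y) * (1 - cutoff n (x, y)) := by
    simp [cutoffMul]
    ring
  have h2 : 0 ≤ 1 - cutoff n (x, y) := sub_nonneg.2 (cutoff_le_one _ _)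
  rw [h1, abs_mul, abs_of_nonneg h2, ← mul_add]
  refine (mul_le_mul_of_nonneg_right (hC (x, y)) h2).trans ?_
  rw [mul_assoc]
  exact mul_le_mul_of_nonneg_left (weight_mul_one_sub_cutoff_le n (x, y)) hC0

open scoped CompactlySupported in
/-- A functional controlled by the marginals is represented by a coupling, on continuous functions
of quadratic growth. -/
theorem MarginalBound.exists_measure [ProperSpace F] {ℓ : quadGrowth F →ₗ[ℝ] ℝ}
    (h : MarginalBound μ ν ℓ) (hμ : Integrable (fun x => ‖x‖ ^ 2) μ)
    (hν : Integrable (fun x => ‖x‖ ^ 2) ν) :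
    ∃ π : Measure (F × F), π.map Prod.fst = μ ∧ π.map Prod.snd = ν ∧
      ∀ f : quadGrowth F, Continuous f.1 → ∫ z, f.1 z ∂π = ℓ f := by
  let Λ₀ : C_c(F × F, ℝ) →ₗ[ℝ] ℝ :=
    { toFun := fun f => ℓ ⟨f, quadGrowth.of_hasCompactSupport f.continuous f.hasCompactSupport⟩
      map_add' := fun f g => by rw [← map_add]; rfl
      map_smul' := fun c f => by rw [← map_smul]; rfl }
  let Λ : C_c(F × F, ℝ) →ₚ[ℝ] ℝ := PositiveLinearMap.mk₀ Λ₀ fun f hf => h.nonneg hf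
  let π := RealRMK.rieszMeasure Λ
  have hπ : ∀ f : quadGrowth F, Continuous f.1 → ∀ n,
      ∫ z, f.1 z * cutoff n z ∂π = ℓ (cutoffMul f n) := by
    intro f hf n
    exact RealRMK.integral_rieszMeasure Λ
      ⟨⟨fun z => f.1 z * cutoff n z, hf.mul (continuous_cutoff n)⟩,
        hasCompactSupport_mul_cutoff f.1 n⟩
  have hint : ∀ f : quadGrowth F, Continuous f.1 → ∀ n,
      Integrable (fun z => f.1 z * cutoff n z) π := fun f hf n =>
    (hf.mul (continuous_cutoff n)).integrable_of_hasCompactSupport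
      (hasCompactSupport_mul_cutoff f.1 n)
  let w : quadGrowth F := ⟨fun z => 1 + ‖z.1‖ ^ 2 + ‖z.2‖ ^ 2, 1, fun z => by
    rw [one_mul, abs_of_nonneg (by positivity)]⟩
  have hwc : Continuous w.1 := by
    change Continuous fun z : F × F => 1 + ‖z.1‖ ^ 2 + ‖z.2‖ ^ 2
    fun_prop
  have hw0 : ∀ z, 0 ≤ w.1 z := fun z => by
    change 0 ≤ 1 + ‖z.1‖ ^ 2 + ‖z.2‖ ^ 2
    positivity
  have hw : Integrable w.1 π := by
    refine (aecover_closedBall (x := (0 : F × F)) (μ := π)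
      tendsto_natCast_atTop_atTop).integrable_of_lintegral_enorm_bounded
      (∫ x, (1 + ‖x‖ ^ 2) ∂μ + ∫ y, ‖y‖ ^ 2 ∂ν) hwc.aestronglyMeasurable
      (Eventually.of_forall fun n => ?_)
    have h1 : ∫⁻ z in Metric.closedBall 0 (n : ℝ), ‖w.1 z‖ₑ ∂π
        ≤ ∫⁻ z, ENNReal.ofReal (w.1 z * cutoff n z) ∂π := by
      rw [← lintegral_indicator Metric.isClosed_closedBall.measurableSet]
      refine lintegral_mono fun z => ?_
      by_cases hz : z ∈ Metric.closedBall (0 : F × F) n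
      · rw [indicator_of_mem hz, cutoff_eq_one (mem_closedBall_zero_iff.1 hz), mul_one,
          Real.enorm_of_nonneg (hw0 z)]
      · rw [indicator_of_notMem hz]
        exact zero_le
    refine h1.trans ?_
    rw [← ofReal_integral_eq_lintegral_ofReal (hint w hwc n)
      (ae_of_all _ fun z => mul_nonneg (hw0 z) (cutoff_nonneg n z)), hπ w hwc]
    refine ENNReal.ofReal_le_ofReal (h _ _ _ ((integrable_const 1).add hμ) hν fun x y => ?_)
    exact mul_le_of_le_one_right (hw0 (x, y)) (cutoff_le_one _ _)
  have hrep : ∀ f : quadGrowth F, Continuous f.1 → ∫ z, f.1 z ∂π = ℓ f := by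
    intro f hf
    obtain ⟨C, hC⟩ := f.2
    have h1 : Tendsto (fun n => ∫ z, f.1 z * cutoff n z ∂π) atTop (𝓝 (∫ z, f.1 z ∂π)) := by
      refine tendsto_integral_of_dominated_convergence (fun z => C * w.1 z)
        (fun n => (hint f hf n).1) (hw.const_mul C) (fun n => ae_of_all _ fun z => ?_)
        (ae_of_all _ fun z => ?_)
      · rw [Real.norm_eq_abs, abs_mul, abs_of_nonneg (cutoff_nonneg n z)]
        exact (mul_le_of_le_one_right (abs_nonneg _) (cutoff_le_one n z)).trans (hC z)
      · simpa using (tendsto_cutoff z).const_mul (f.1 z)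
    simp_rw [hπ f hf] at h1
    exact tendsto_nhds_unique h1 (h.tendsto_cutoffMul hμ hν f)
  have hfin : IsFiniteMeasure π := by
    have h1 : Integrable (fun _ => (1 : ℝ)) π := by
      refine hw.mono' aestronglyMeasurable_const (ae_of_all _ fun z => ?_)
      change ‖(1 : ℝ)‖ ≤ 1 + ‖z.1‖ ^ 2 + ‖z.2‖ ^ 2
      rw [norm_one]
      nlinarith [sq_nonneg ‖z.1‖, sq_nonneg ‖z.2‖]
    exact (integrable_const_iff_isFiniteMeasure one_ne_zero).1 h1
  refine ⟨π, ?_, ?_, hrep⟩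
  · refine ext_of_forall_integral_eq_of_IsFiniteMeasure fun φ => ?_
    -- A function of one variable is its own decoupled bound, and so is its negative; the two
    -- inequalities identify the marginal.
    let f : quadGrowth F := ⟨fun z => φ z.1, quadGrowth.of_bounded fun z => φ.norm_coe_le_norm z.1⟩
    rw [integral_map measurable_fst.aemeasurable φ.continuous.aestronglyMeasurable]
    have h1 := hrep f (φ.continuous.comp continuous_fst)
    have h2 := h f φ (fun _ => 0) (φ.integrable μ) (integrable_zero _ _ _) fun x y => by simp [f]
    have h3 := h (-f) (-φ) (fun _ => 0) (φ.integrable μ).neg (integrable_zero _ _ _)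
      fun x y => by simp [f]
    simp only [map_neg, integral_zero, add_zero, Pi.neg_apply, integral_neg] at h2 h3
    exact h1.trans (le_antisymm h2 (neg_le_neg_iff.1 h3))
  · refine ext_of_forall_integral_eq_of_IsFiniteMeasure fun φ => ?_
    let f : quadGrowth F := ⟨fun z => φ z.2, quadGrowth.of_bounded fun z => φ.norm_coe_le_norm z.2⟩
    rw [integral_map measurable_snd.aemeasurable φ.continuous.aestronglyMeasurable]
    have h1 := hrep f (φ.continuous.comp continuous_snd)
    have h2 := h f (fun _ => 0) φ (integrable_zero _ _ _) (φ.integrable ν) fun x y => by simp [f]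
    have h3 := h (-f) (fun _ => 0) (-φ) (integrable_zero _ _ _) (φ.integrable ν).neg
      fun x y => by simp [f]
    simp only [map_neg, integral_zero, zero_add, Pi.neg_apply, integral_neg] at h2 h3
    exact h1.trans (le_antisymm h2 (neg_le_neg_iff.1 h3))

/-- Given a sublinear functional `q` controlled by the marginals and a continuous function `g`,
there is a coupling under which the integral of `g` is `q g` and which is dominated by `q`. -/
theorem MarginalBound.exists_measure_of_sublinear [ProperSpace F] {q : quadGrowth F → ℝ}
    (h : MarginalBound μ ν q) (hμ : Integrable (fun x => ‖x‖ ^ 2) μ)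
    (hν : Integrable (fun x => ‖x‖ ^ 2) ν) (hsmul : ∀ c : ℝ, 0 < c → ∀ f, q (c • f) = c * q f)
    (hadd : ∀ f g, q (f + g) ≤ q f + q g) (g : quadGrowth F) (hg : Continuous g.1) :
    ∃ π : Measure (F × F), π.map Prod.fst = μ ∧ π.map Prod.snd = ν ∧ ∫ z, g.1 z ∂π = q g ∧
      ∀ f : quadGrowth F, Continuous f.1 → ∫ z, f.1 z ∂π ≤ q f := by
  have h0 : q 0 = 0 := by
    have := hsmul 2 two_pos 0
    rw [smul_zero] at this
    linarith
  let L : quadGrowth F →ₗ.[ℝ] ℝ := LinearPMap.mkSpanSingleton' g (q g) fun c hc => by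
    rcases smul_eq_zero.1 hc with h1 | h1
    · simp [h1]
    · simp [h1, h0]
  obtain ⟨ℓ, hℓL, hℓq⟩ := exists_extension_of_le_sublinear L q hsmul hadd (by
    rintro ⟨x, hx⟩
    obtain ⟨a, rfl⟩ := Submodule.mem_span_singleton.1 hx
    have h1 : L ⟨a • g, hx⟩ = a * q g := LinearPMap.mkSpanSingleton'_apply g (q g) _ a hx
    rw [h1]
    rcases lt_trichotomy a 0 with ha | rfl | ha
    -- For negative multiples, domination by `q` follows from `0 = q 0 ≤ q (-a • g) + q (a • g)`.
    · have h2 := hadd ((-a) • g) (a • g)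
      rw [hsmul _ (neg_pos.2 ha), ← add_smul, neg_add_cancel, zero_smul, h0] at h2
      simp only
      linarith
    · simp [h0]
    · exact (hsmul a ha g).ge)
  have hℓ : MarginalBound μ ν ℓ := fun f φ ψ hφ hψ hf => (hℓq f).trans (h f φ ψ hφ hψ hf)
  obtain ⟨π, h1, h2, h3⟩ := hℓ.exists_measure hμ hν
  refine ⟨π, h1, h2, ?_, fun f hf => (h3 f hf).trans_le (hℓq f)⟩
  rw [h3 g hg]
  have hm : (1 : ℝ) • g ∈ L.domain :=
    Submodule.smul_mem _ _ (Submodule.mem_span_singleton_self g)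
  have h4 := hℓL ⟨(1 : ℝ) • g, hm⟩
  have h5 : L ⟨(1 : ℝ) • g, hm⟩ = 1 * q g :=
    LinearPMap.mkSpanSingleton'_apply g (q g) _ 1 hm
  rw [h5, one_mul] at h4
  simpa using h4

end QuadraticGrowth

/-! ### Kantorovich duality and control by the optimality gap. -/

section Duality

variable {F : Type*} [NormedAddCommGroup F] [MeasurableSpace F]

/-- The infimum of the dual transport problem for the reward `f`. -/
noncomputable def dualInf (μ ν : Measure F) (f : quadGrowth F) : ℝ :=
  sInf {r | ∃ φ ψ : F → ℝ, Integrable φ μ ∧ Integrable ψ ν ∧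
    (∀ x y, f.1 (x, y) ≤ φ x + ψ y) ∧ r = ∫ x, φ x ∂μ + ∫ y, ψ y ∂ν}

theorem isProbabilityMeasure_of_map {α β : Type*} [MeasurableSpace α] [MeasurableSpace β]
    {π : Measure α} {m : Measure β} [hm : IsProbabilityMeasure m] {f : α → β} (hf : Measurable f)
    (h : π.map f = m) : IsProbabilityMeasure π := by
  constructor
  rw [← preimage_univ (f := f), ← Measure.map_apply hf MeasurableSet.univ, h, measure_univ]

theorem integral_fst {α β : Type*} [MeasurableSpace α] [MeasurableSpace β] {μ : Measure α}
    {π : Measure (α × β)} (h : π.map Prod.fst = μ) {φ : α → ℝ} (hφ : Integrable φ μ) :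
    Integrable (fun z : α × β => φ z.1) π ∧ ∫ z, φ z.1 ∂π = ∫ x, φ x ∂μ := by
  subst h
  exact ⟨hφ.comp_measurable measurable_fst,
    (integral_map measurable_fst.aemeasurable hφ.1).symm⟩

theorem integral_snd {α β : Type*} [MeasurableSpace α] [MeasurableSpace β] {ν : Measure β}
    {π : Measure (α × β)} (h : π.map Prod.snd = ν) {ψ : β → ℝ} (hψ : Integrable ψ ν) :
    Integrable (fun z : α × β => ψ z.2) π ∧ ∫ z, ψ z.2 ∂π = ∫ y, ψ y ∂ν := by
  subst h
  exact ⟨hψ.comp_measurable measurable_snd,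
    (integral_map measurable_snd.aemeasurable hψ.1).symm⟩

theorem integral_le_of_le_add {α β : Type*} [MeasurableSpace α] [MeasurableSpace β]
    {μ : Measure α} {ν : Measure β} {π : Measure (α × β)} (h1 : π.map Prod.fst = μ)
    (h2 : π.map Prod.snd = ν) {f : α × β → ℝ} (hf : Integrable f π) {φ : α → ℝ} {ψ : β → ℝ}
    (hφ : Integrable φ μ) (hψ : Integrable ψ ν) (h : ∀ x y, f (x, y) ≤ φ x + ψ y) :
    ∫ z, f z ∂π ≤ ∫ x, φ x ∂μ + ∫ y, ψ y ∂ν := by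
  rw [← (integral_fst h1 hφ).2, ← (integral_snd h2 hψ).2,
    ← integral_add (integral_fst h1 hφ).1 (integral_snd h2 hψ).1]
  exact integral_mono hf ((integral_fst h1 hφ).1.add (integral_snd h2 hψ).1) fun z => h z.1 z.2

variable {μ ν : Measure F} [IsProbabilityMeasure μ]

theorem integrable_of_mem_quadGrowth {π : Measure (F × F)} (h1 : π.map Prod.fst = μ)
    (h2 : π.map Prod.snd = ν) (hμ : Integrable (fun x => ‖x‖ ^ 2) μ)
    (hν : Integrable (fun x => ‖x‖ ^ 2) ν) {f : F × F → ℝ} (hf : f ∈ quadGrowth F)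
    (hfm : AEStronglyMeasurable f π) : Integrable f π := by
  obtain ⟨C, hC⟩ := hf
  refine Integrable.mono' (((integral_fst h1 ((integrable_const 1).add hμ)).1.add
    (integral_snd h2 hν).1).const_mul C) hfm (ae_of_all _ hC)

theorem quadGrowth.exists_le (hμ : Integrable (fun x => ‖x‖ ^ 2) μ)
    (hν : Integrable (fun x => ‖x‖ ^ 2) ν) (f : quadGrowth F) :
    ∃ φ ψ : F → ℝ, Integrable φ μ ∧ Integrable ψ ν ∧ ∀ x y, |f.1 (x, y)| ≤ φ x + ψ y := by
  obtain ⟨C, hC⟩ := f.2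
  refine ⟨fun x => C * (1 + ‖x‖ ^ 2), fun y => C * ‖y‖ ^ 2,
    ((integrable_const 1).add hμ).const_mul C, hν.const_mul C, fun x y => ?_⟩
  rw [← mul_add]
  exact hC (x, y)

theorem le_dualInf (hμ : Integrable (fun x => ‖x‖ ^ 2) μ) (hν : Integrable (fun x => ‖x‖ ^ 2) ν)
    {f : quadGrowth F} {b : ℝ} (h : ∀ φ ψ : F → ℝ, Integrable φ μ → Integrable ψ ν →
      (∀ x y, f.1 (x, y) ≤ φ x + ψ y) → b ≤ ∫ x, φ x ∂μ + ∫ y, ψ y ∂ν) : b ≤ dualInf μ ν f := by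
  obtain ⟨φ₀, ψ₀, hφ₀, hψ₀, h₀⟩ := quadGrowth.exists_le hμ hν f
  refine le_csInf ⟨_, φ₀, ψ₀, hφ₀, hψ₀, fun x y => (le_abs_self _).trans (h₀ x y), rfl⟩ ?_
  rintro r ⟨φ, ψ, hφ, hψ, h', rfl⟩
  exact h φ ψ hφ hψ h'

theorem integral_le_dualInf (hμ : Integrable (fun x => ‖x‖ ^ 2) μ)
    (hν : Integrable (fun x => ‖x‖ ^ 2) ν) {π : Measure (F × F)} (h1 : π.map Prod.fst = μ)
    (h2 : π.map Prod.snd = ν) {f : quadGrowth F} (hf : AEStronglyMeasurable f.1 π) :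
    ∫ z, f.1 z ∂π ≤ dualInf μ ν f :=
  le_dualInf hμ hν fun _ _ hφ hψ h =>
    integral_le_of_le_add h1 h2 (integrable_of_mem_quadGrowth h1 h2 hμ hν f.2 hf) hφ hψ h

variable [IsProbabilityMeasure ν]

theorem dualInf_le (hμ : Integrable (fun x => ‖x‖ ^ 2) μ) (hν : Integrable (fun x => ‖x‖ ^ 2) ν)
    {f : quadGrowth F} {φ ψ : F → ℝ} (hφ : Integrable φ μ) (hψ : Integrable ψ ν)
    (h : ∀ x y, f.1 (x, y) ≤ φ x + ψ y) : dualInf μ ν f ≤ ∫ x, φ x ∂μ + ∫ y, ψ y ∂ν := by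
  refine csInf_le ?_ ⟨φ, ψ, hφ, hψ, h, rfl⟩
  obtain ⟨φ₀, ψ₀, hφ₀, hψ₀, h₀⟩ := quadGrowth.exists_le hμ hν f
  refine ⟨-(∫ x, φ₀ x ∂μ + ∫ y, ψ₀ y ∂ν), ?_⟩
  rintro r ⟨φ', ψ', hφ', hψ', h', rfl⟩
  -- Testing against the product coupling bounds the dual values from below.
  have h1 := integral_le_of_le_add (π := μ.prod ν) (μ := μ) (ν := ν) (by simp) (by simp)
    (integrable_zero _ _ _) (hφ'.add hφ₀) (hψ'.add hψ₀) (f := fun _ => 0) fun x y => by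
      simp only [Pi.add_apply]
      linarith [h' x y, h₀ x y, neg_abs_le (f.1 (x, y))]
  simp only [integral_zero, Pi.add_apply] at h1
  rw [integral_add hφ' hφ₀, integral_add hψ' hψ₀] at h1
  linarith

theorem dualInf_add_le (hμ : Integrable (fun x => ‖x‖ ^ 2) μ)
    (hν : Integrable (fun x => ‖x‖ ^ 2) ν) (f g : quadGrowth F) :
    dualInf μ ν (f + g) ≤ dualInf μ ν f + dualInf μ ν g := by
  rw [← sub_le_iff_le_add]
  refine le_dualInf hμ hν fun φ ψ hφ hψ h => ?_
  rw [sub_le_comm]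
  refine le_dualInf hμ hν fun φ' ψ' hφ' hψ' h' => ?_
  have h1 := dualInf_le hμ hν (f := f + g) (hφ.add hφ') (hψ.add hψ') fun x y => by
    change f.1 (x, y) + g.1 (x, y) ≤ (φ x + φ' x) + (ψ y + ψ' y)
    linarith [h x y, h' x y]
  simp only [Pi.add_apply] at h1
  rw [integral_add hφ hφ', integral_add hψ hψ'] at h1
  linarith

/-- The reverse inequality is the hypothesis for `c⁻¹` at the vector `c • f`. -/
theorem eq_smul_of_le {V : Type*} [AddCommGroup V] [Module ℝ V] {q : V → ℝ}
    (h : ∀ c : ℝ, 0 < c → ∀ f, c⁻¹ * q (c • f) ≤ q f) (c : ℝ) (hc : 0 < c) (f : V) :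
    q (c • f) = c * q f := by
  apply le_antisymm
  · rw [← inv_mul_le_iff₀ hc]
    exact h c hc f
  · have := h c⁻¹ (inv_pos.2 hc) (c • f)
    rwa [inv_smul_smul₀ hc.ne', inv_inv] at this

theorem dualInf_smul (hμ : Integrable (fun x => ‖x‖ ^ 2) μ)
    (hν : Integrable (fun x => ‖x‖ ^ 2) ν) (c : ℝ) (hc : 0 < c) (f : quadGrowth F) :
    dualInf μ ν (c • f) = c * dualInf μ ν f := by
  refine eq_smul_of_le (fun c hc f => ?_) c hc f
  refine le_dualInf hμ hν fun φ ψ hφ hψ h => ?_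
  rw [inv_mul_le_iff₀ hc, mul_add, ← integral_const_mul, ← integral_const_mul]
  refine dualInf_le hμ hν (hφ.const_mul c) (hψ.const_mul c) fun x y => ?_
  rw [← mul_add]
  exact mul_le_mul_of_nonneg_left (h x y) hc.le

theorem dualInf_zero (hμ : Integrable (fun x => ‖x‖ ^ 2) μ)
    (hν : Integrable (fun x => ‖x‖ ^ 2) ν) : dualInf μ ν 0 = 0 := by
  have := dualInf_smul hμ hν 2 two_pos 0
  rw [smul_zero] at this
  linarith

variable [BorelSpace F] [ProperSpace F]

/-- Kantorovich duality for continuous rewards of quadratic growth. -/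
theorem exists_integral_eq_dualInf (hμ : Integrable (fun x => ‖x‖ ^ 2) μ)
    (hν : Integrable (fun x => ‖x‖ ^ 2) ν) (f : quadGrowth F) (hf : Continuous f.1) :
    ∃ π : Measure (F × F), π.map Prod.fst = μ ∧ π.map Prod.snd = ν ∧
      ∫ z, f.1 z ∂π = dualInf μ ν f := by
  have h : MarginalBound μ ν (dualInf μ ν) := fun f φ ψ hφ hψ h => dualInf_le hμ hν hφ hψ h
  obtain ⟨π, h1, h2, h3, -⟩ := h.exists_measure_of_sublinear hμ hν (dualInf_smul hμ hν)
    (dualInf_add_le hμ hν) f hf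
  exact ⟨π, h1, h2, h3⟩

/-- A bound on the integral of `g` under the optimal couplings for the reward `f` extends to all
couplings, up to an arbitrarily small error and a multiple of the optimality gap. -/
theorem exists_integral_le_add_gap (hμ : Integrable (fun x => ‖x‖ ^ 2) μ)
    (hν : Integrable (fun x => ‖x‖ ^ 2) ν) (f g : quadGrowth F) (hf : Continuous f.1)
    (hg : Continuous g.1) {b : ℝ}
    (hb : ∀ π : Measure (F × F), π.map Prod.fst = μ → π.map Prod.snd = ν →
      ∫ z, f.1 z ∂π = dualInf μ ν f → ∫ z, g.1 z ∂π ≤ b) {ε : ℝ} (hε : 0 < ε) :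
    ∃ t : ℝ, 0 ≤ t ∧ ∀ π : Measure (F × F), π.map Prod.fst = μ → π.map Prod.snd = ν →
      ∫ z, g.1 z ∂π ≤ b + ε + t * (dualInf μ ν f - ∫ z, f.1 z ∂π) := by
  let p := dualInf μ ν
  have hp_add := dualInf_add_le hμ hν
  have hp_smul := dualInf_smul hμ hν
  have hp_smul' : ∀ t : NNReal, p (t.1 • f) = t * p f := by
    intro t
    rcases eq_or_lt_of_le' t.2 with h | h
    · rw [h, zero_smul]
      simp [p, dualInf_zero hμ hν, show t = 0 from NNReal.eq h]
    · exact hp_smul t.1 h f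
  -- By homogeneity, with `s = 1 / t`, this is the infimum of the difference quotients `(p (f + s h)
  -- - p f) / s`: the directional derivative of `p` at `f`. It is sublinear and at most `p`.
  let q : quadGrowth F → ℝ := fun h => ⨅ t : NNReal, (p (h + t.1 • f) - t * p f)
  have hbdd : ∀ h, BddBelow (range fun t : NNReal => p (h + t.1 • f) - t * p f) := by
    intro h
    refine ⟨-p (-h), ?_⟩
    rintro _ ⟨t, rfl⟩
    have h1 := hp_add (h + t.1 • f) (-h)
    rw [add_neg_cancel_comm] at h1
    have h2 := hp_smul' t
    simp only [p] at h2 ⊢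
    linarith
  have hq_le : ∀ h, ∀ t : NNReal, q h ≤ p (h + t.1 • f) - t * p f := fun h t => ciInf_le (hbdd h) t
  have hqp : ∀ h, q h ≤ p h := fun h => by simpa using hq_le h 0
  have hq_bound : MarginalBound μ ν q := fun h φ ψ hφ hψ hh =>
    (hqp h).trans (dualInf_le hμ hν hφ hψ hh)
  have hq_add : ∀ h k, q (h + k) ≤ q h + q k := by
    intro h k
    rw [← sub_le_iff_le_add]
    refine le_ciInf fun t => ?_
    rw [sub_le_comm]
    refine le_ciInf fun s => ?_
    have h1 := hq_le (h + k) (t + s)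
    have h2 := hp_add (h + t.1 • f) (k + s.1 • f)
    have h3 : h + k + (t + s).1 • f = h + t.1 • f + (k + s.1 • f) := by
      change h + k + (t.1 + s.1) • f = _
      rw [add_smul]
      abel
    rw [h3, NNReal.coe_add] at h1
    simp only [p] at h1 ⊢
    linarith
  have hq_smul : ∀ c : ℝ, 0 < c → ∀ h, q (c • h) = c * q h := by
    refine eq_smul_of_le (q := q) fun c hc h => ?_
    refine le_ciInf fun t => ?_
    rw [inv_mul_le_iff₀ hc]
    have h1 := hq_le (c • h) (⟨c, hc.le⟩ * t)
    have h2 : c • h + ((⟨c, hc.le⟩ * t : NNReal) : ℝ) • f = c • (h + t.1 • f) := by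
      rw [smul_add, smul_smul]
      rfl
    have h3 : p (c • (h + t.1 • f)) = c * p (h + t.1 • f) := hp_smul c hc _
    change q (c • h) ≤ p (c • h + ((⟨c, hc.le⟩ * t : NNReal) : ℝ) • f) - c * t * p f at h1
    rw [h2, h3] at h1
    linarith
  obtain ⟨π, h1, h2, h3, h4⟩ := hq_bound.exists_measure_of_sublinear hμ hν hq_smul hq_add g hg
  -- Domination by `q` forces optimality for `f`: `t = 1` gives `q (-f) ≤ -p f`. Hence `hb` applies
  -- to `π` and bounds `q g`, and a nearly minimizing `t` for `q g` is the required multiple.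
  have h5 : ∫ z, f.1 z ∂π = p f := by
    refine le_antisymm (integral_le_dualInf hμ hν h1 h2 hf.aestronglyMeasurable) ?_
    have h6 := h4 (-f) hf.neg
    have h7 := hq_le (-f) 1
    have h8 : -f + (1 : NNReal).1 • f = 0 := by
      change -f + (1 : ℝ) • f = 0
      rw [one_smul, neg_add_cancel]
    rw [h8] at h7
    change ∫ z, -f.1 z ∂π ≤ _ at h6
    rw [integral_neg] at h6
    simp only [p, dualInf_zero hμ hν, NNReal.coe_one] at h7 ⊢
    linarith
  have h6 : q g < b + ε := by
    rw [← h3]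
    exact (hb π h1 h2 h5).trans_lt (lt_add_of_pos_right b hε)
  obtain ⟨t, ht⟩ := exists_lt_of_ciInf_lt h6
  refine ⟨t, t.2, fun π' h1' h2' => ?_⟩
  have hc : Continuous (g + t.1 • f).1 := hg.add (hf.const_smul t.1)
  have h7 := integral_le_dualInf hμ hν h1' h2' (f := g + t.1 • f) hc.aestronglyMeasurable
  have h8 : ∫ z, (g + t.1 • f).1 z ∂π' = ∫ z, g.1 z ∂π' + t * ∫ z, f.1 z ∂π' := by
    rw [← integral_const_mul]
    refine integral_add ?_ (Integrable.const_mul ?_ _)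
    · exact integrable_of_mem_quadGrowth h1' h2' hμ hν g.2 hg.aestronglyMeasurable
    · exact integrable_of_mem_quadGrowth h1' h2' hμ hν f.2 hf.aestronglyMeasurable
  rw [h8] at h7
  simp only [p] at ht
  linarith

end Duality

/-! ### Differentiability of support functions (Šmulian). -/

section SupportFunction

variable {H : Type*} [NormedAddCommGroup H] [InnerProductSpace ℝ H]

/-- `σ` is the support function of the set `S`. -/
def IsSupportFunction (S : Set H) (σ : H → ℝ) : Prop :=
  ∀ Z, IsLUB ((fun Y => inner ℝ Z Y) '' S) (σ Z)

theorem IsSupportFunction.inner_le {S : Set H} {σ : H → ℝ} (h : IsSupportFunction S σ) (Z : H)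
    {Y : H} (hY : Y ∈ S) : inner ℝ Z Y ≤ σ Z :=
  (h Z).1 (mem_image_of_mem _ hY)

theorem IsSupportFunction.exists_lt {S : Set H} {σ : H → ℝ} (h : IsSupportFunction S σ) (Z : H)
    {ε : ℝ} (hε : 0 < ε) : ∃ Y ∈ S, σ Z - ε < inner ℝ Z Y := by
  obtain ⟨_, ⟨Y, hY, rfl⟩, h1, -⟩ := (h Z).exists_between (sub_lt_self (σ Z) hε)
  exact ⟨Y, hY, h1⟩

variable [CompleteSpace H]

/-- If all almost maximizers of `⟪X, ·⟫` in `S` are close to `D`, then the support function of `S`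
has gradient `D` at `X` (Šmulian). -/
theorem IsSupportFunction.hasGradientAt {S : Set H} {σ : H → ℝ} (h : IsSupportFunction S σ) {R : ℝ}
    (hR : ∀ Y ∈ S, ‖Y‖ ≤ R) {X D : H} (hD : D ∈ S) (hXD : inner ℝ X D = σ X)
    (hstab : ∀ δ > 0, ∃ η > 0, ∀ Y ∈ S, σ X - η < inner ℝ X Y → ‖Y - D‖ ≤ δ) :
    HasGradientAt σ D X := by
  rw [hasGradientAt_iff_isLittleO, Asymptotics.isLittleO_iff]
  intro δ hδ
  obtain ⟨η, hη, hY⟩ := hstab δ hδ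
  have hR0 : 0 ≤ R := (norm_nonneg _).trans (hR D hD)
  -- On this ball `⟪Z - X, ·⟫` is below `η / 4` in absolute value on `S`. An `η / 2`-maximizer at
  -- `Z` is therefore an `η`-maximizer at `X`: `η / 2 + η / 4 + η / 4`.
  have hr : 0 < η / (4 * (R + 1)) := by positivity
  filter_upwards [Metric.ball_mem_nhds X hr] with Z hZ
  rw [mem_ball_iff_norm, lt_div_iff₀ (by positivity)] at hZ
  have hinner : ∀ Y ∈ S, |inner ℝ (Z - X) Y| ≤ R * ‖Z - X‖ := fun Y hY =>
    (abs_real_inner_le_norm _ _).trans (by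
      rw [mul_comm]
      exact mul_le_mul_of_nonneg_right (hR Y hY) (norm_nonneg _))
  have hlow : 0 ≤ σ Z - σ X - inner ℝ D (Z - X) := by
    have h1 := h.inner_le Z hD
    rw [real_inner_comm, inner_sub_left, hXD]
    linarith
  rw [Real.norm_eq_abs, abs_of_nonneg hlow]
  refine le_of_forall_pos_le_add fun κ' hκ' => ?_
  obtain ⟨κ, hκ, hκη, hκκ⟩ : ∃ κ > 0, κ ≤ η / 2 ∧ κ ≤ κ' :=
    ⟨min (η / 2) κ', lt_min (half_pos hη) hκ', min_le_left _ _, min_le_right _ _⟩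
  obtain ⟨Y, hYS, hYZ⟩ := h.exists_lt Z hκ
  have h1 := abs_le.1 (hinner Y hYS)
  have h2 := abs_le.1 (hinner D hD)
  have h3 := h.inner_le Z hD
  have h4 := h.inner_le X hYS
  rw [inner_sub_left] at h1 h2
  have h5 := hY Y hYS (by nlinarith [norm_nonneg (Z - X)])
  have h6 : inner ℝ (Z - X) (Y - D) ≤ ‖Z - X‖ * δ :=
    (real_inner_le_norm _ _).trans (mul_le_mul_of_nonneg_left h5 (norm_nonneg _))
  rw [inner_sub_right, inner_sub_left, inner_sub_left] at h6
  rw [real_inner_comm, inner_sub_left]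
  linarith

/-- If the support function of `S` has gradient `D` at `X`, then all almost maximizers of `⟪X, ·⟫`
in `S` are close to `D` (Šmulian). -/
theorem IsSupportFunction.norm_sub_le_of_hasGradientAt {S : Set H} {σ : H → ℝ}
    (h : IsSupportFunction S σ) {X D : H} (hD : HasGradientAt σ D X) {δ : ℝ} (hδ : 0 < δ) :
    ∃ η > 0, ∀ Y ∈ S, σ X - η < inner ℝ X Y → ‖Y - D‖ ≤ δ := by
  rw [hasGradientAt_iff_isLittleO, Asymptotics.isLittleO_iff] at hD
  obtain ⟨s, hs, hball⟩ := Metric.eventually_nhds_iff.1 (hD (half_pos hδ))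
  refine ⟨s / 2 * (δ / 2), by positivity, fun Y hY hYX => ?_⟩
  by_contra! hlt
  have hpos : 0 < ‖Y - D‖ := hδ.trans hlt
  -- Moving from `X` by `s / 2` towards `Y - D` lifts `σ` above its linearisation by more than `s /
  -- 2 * δ - η = s / 2 * (δ / 2)`, which is all that differentiability allows.
  let v : H := (s / 2 / ‖Y - D‖) • (Y - D)
  have hv : ‖v‖ = s / 2 := by
    rw [norm_smul, Real.norm_of_nonneg (by positivity), div_mul_cancel₀ _ hpos.ne']
  have h1 := hball (y := X + v) (by rw [dist_eq_norm, add_sub_cancel_left, hv]; linarith)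
  rw [add_sub_cancel_left, hv] at h1
  have h2 := (le_abs_self _).trans h1
  have h3 := h.inner_le (X + v) hY
  rw [inner_add_left] at h3
  have h4 : inner ℝ v Y - inner ℝ D v = s / 2 * ‖Y - D‖ := by
    rw [real_inner_comm v D, ← inner_sub_right, real_inner_smul_left, real_inner_self_eq_norm_sq]
    field_simp
  nlinarith

end SupportFunction

/-! ### The Wasserstein distance in terms of the maximal correlation. -/

section Euclidean

variable {d : ℕ}

instance (μ : P2 d) : IsProbabilityMeasure μ.meas := μ.2.1

theorem P2.memLp_id (μ : P2 d) : MemLp id 2 μ.meas := by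
  refine ⟨aestronglyMeasurable_id, ?_⟩
  rw [eLpNorm_lt_top_iff_lintegral_rpow_enorm_lt_top two_ne_zero ENNReal.ofNat_ne_top]
  simpa [P2.meas] using μ.2.2

theorem P2.integrable_sq (μ : P2 d) : Integrable (fun x => ‖x‖ ^ 2) μ.meas :=
  (memLp_two_iff_integrable_sq_norm aestronglyMeasurable_id).1 μ.memLp_id

theorem P2.integrable_norm (μ : P2 d) : Integrable (fun x => ‖x‖) μ.meas :=
  (μ.memLp_id.integrable one_le_two).norm

/-- The second order moment. -/
noncomputable def P2.moment (μ : P2 d) : ℝ := ∫ x, ‖x‖ ^ 2 ∂μ.meas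

/-- The scalar product, as a function of quadratic growth. -/
noncomputable def corr (d : ℕ) : quadGrowth (E d) :=
  ⟨fun z => inner ℝ z.1 z.2, 1, fun z => by
    have h1 := abs_real_inner_le_norm z.1 z.2
    nlinarith [sq_nonneg (‖z.1‖ - ‖z.2‖), sq_nonneg ‖z.1‖, sq_nonneg ‖z.2‖]⟩

theorem continuous_corr : Continuous (corr d).1 := by
  change Continuous fun z : E d × E d => inner ℝ z.1 z.2
  fun_prop

/-- The maximal correlation of two measures. -/
noncomputable def maxCorr (μ ν : P2 d) : ℝ := dualInf μ.meas ν.meas (corr d)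

theorem integrable_corr {μ ν : P2 d} {π : Measure (E d × E d)} (h : π ∈ couplings μ ν) :
    Integrable (fun z => inner ℝ z.1 z.2) π :=
  integrable_of_mem_quadGrowth h.1 h.2 μ.integrable_sq ν.integrable_sq (corr d).2
    continuous_corr.aestronglyMeasurable

theorem integral_corr_le {μ ν : P2 d} {π : Measure (E d × E d)} (h : π ∈ couplings μ ν) :
    ∫ z, inner ℝ z.1 z.2 ∂π ≤ maxCorr μ ν :=
  integral_le_dualInf μ.integrable_sq ν.integrable_sq h.1 h.2
    continuous_corr.aestronglyMeasurable (f := corr d)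

theorem exists_integral_corr_eq (μ ν : P2 d) :
    ∃ π ∈ couplings μ ν, ∫ z, inner ℝ z.1 z.2 ∂π = maxCorr μ ν := by
  obtain ⟨π, h1, h2, h3⟩ := exists_integral_eq_dualInf μ.integrable_sq ν.integrable_sq (corr d)
    continuous_corr
  exact ⟨π, ⟨h1, h2⟩, h3⟩

theorem norm_sub_sq_eq_sub (x y : E d) : ‖x - y‖ ^ 2 = ‖x‖ ^ 2 + ‖y‖ ^ 2 - 2 * inner ℝ x y := by
  rw [norm_sub_sq_real]
  ring

/-- The marginals fix both second moments, so minimizing the cost is maximizing the correlation.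
Nonnegativity is recorded because `ENNReal.ofReal` is injective only there. -/
theorem cost_eq {μ ν : P2 d} {π : Measure (E d × E d)} (h : π ∈ couplings μ ν) :
    cost π = ENNReal.ofReal (μ.moment + ν.moment - 2 * ∫ z, inner ℝ z.1 z.2 ∂π) ∧
      0 ≤ μ.moment + ν.moment - 2 * ∫ z, inner ℝ z.1 z.2 ∂π := by
  have h1 := integral_fst h.1 μ.integrable_sq
  have h2 := integral_snd h.2 ν.integrable_sq
  have h3 := (integrable_corr h).const_mul 2
  have h4 : (fun z : E d × E d => ‖z.2 - z.1‖ ^ 2)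
      = fun z => ‖z.1‖ ^ 2 + ‖z.2‖ ^ 2 - 2 * inner ℝ z.1 z.2 := by
    ext z
    rw [norm_sub_rev, norm_sub_sq_eq_sub]
  have h5 : ∫ z, ‖z.2 - z.1‖ ^ 2 ∂π
      = μ.moment + ν.moment - 2 * ∫ z, inner ℝ z.1 z.2 ∂π := by
    have h6 := integral_sub (h1.1.add h2.1) h3
    simp only [Pi.add_apply] at h6
    rw [h4, h6, integral_add h1.1 h2.1, h1.2, h2.2,
      integral_const_mul]
    rfl
  have h6 : Integrable (fun z : E d × E d => ‖z.2 - z.1‖ ^ 2) π := by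
    rw [h4]
    exact (h1.1.add h2.1).sub h3
  rw [← h5]
  refine ⟨?_, integral_nonneg fun z => sq_nonneg _⟩
  rw [ofReal_integral_eq_lintegral_ofReal h6 (ae_of_all _ fun z => sq_nonneg _)]
  refine lintegral_congr fun z => ?_
  rw [ENNReal.ofReal_pow (norm_nonneg _), ofReal_norm]

theorem minCost_eq (μ ν : P2 d) :
    minCost μ ν = ENNReal.ofReal (μ.moment + ν.moment - 2 * maxCorr μ ν) ∧
      0 ≤ μ.moment + ν.moment - 2 * maxCorr μ ν := by
  obtain ⟨π, h, hπ⟩ := exists_integral_corr_eq μ ν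
  have h1 := cost_eq h
  rw [hπ] at h1
  refine ⟨le_antisymm ((iInf₂_le π h).trans_eq h1.1) ?_, h1.2⟩
  refine le_iInf₂ fun π' h' => ?_
  rw [(cost_eq h').1]
  exact ENNReal.ofReal_le_ofReal (by linarith [integral_corr_le h'])

theorem W2sq_eq (μ ν : P2 d) : W2sq μ ν = μ.moment + ν.moment - 2 * maxCorr μ ν := by
  rw [W2sq, (minCost_eq μ ν).1, ENNReal.toReal_ofReal (minCost_eq μ ν).2]

theorem mem_optCouplings_iff {μ ν : P2 d} {π : Measure (E d × E d)} :
    π ∈ optCouplings μ ν ↔ π ∈ couplings μ ν ∧ ∫ z, inner ℝ z.1 z.2 ∂π = maxCorr μ ν := by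
  refine and_congr_right fun h => ?_
  rw [(cost_eq h).1, (minCost_eq μ ν).1, ENNReal.ofReal_eq_ofReal_iff (cost_eq h).2
    (minCost_eq μ ν).2]
  constructor <;> intro h1 <;> linarith

end Euclidean

/-! ### Random vectors with prescribed laws and the dual formulation. -/

section Law

variable {Ω : Type*} [MeasurableSpace Ω] {P : Measure Ω} {d : ℕ}

theorem measurable_Lp (X : Lp (E d) 2 P) : Measurable X := (Lp.stronglyMeasurable X).measurable

theorem P2.memLp_of_map_eq {ν : P2 d} {Y : Ω → E d} (hY : Measurable Y) (h : P.map Y = ν.meas) :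
    MemLp Y 2 P := by
  have h1 := ν.memLp_id
  rw [← h, memLp_map_measure_iff aestronglyMeasurable_id hY.aemeasurable] at h1
  exact h1

theorem norm_sq_eq_integral (X : Lp (E d) 2 P) : ‖X‖ ^ 2 = ∫ ω, ‖X ω‖ ^ 2 ∂P := by
  rw [← real_inner_self_eq_norm_sq, L2.inner_def]
  simp_rw [real_inner_self_eq_norm_sq]

theorem inner_eq_integral_map (X Y : Lp (E d) 2 P) :
    inner ℝ X Y = ∫ z, inner ℝ z.1 z.2 ∂(P.map fun ω => (X ω, Y ω)) := by
  rw [L2.inner_def, integral_map ((measurable_Lp X).prodMk (measurable_Lp Y)).aemeasurable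
    (by fun_prop)]

variable [IsProbabilityMeasure P]

theorem law_toLp {ν : P2 d} {Y : Ω → E d} (hY : MemLp Y 2 P) (h : P.map Y = ν.meas) :
    law P (hY.toLp Y) = ν := by
  refine Subtype.ext ?_
  exact (Measure.map_congr hY.coeFn_toLp).trans h

theorem Atomless.exists_law_eq (hP : Atomless P) (μ : P2 d) : ∃ X : Lp (E d) 2 P, law P X = μ := by
  obtain ⟨U, hU, hUm⟩ := hP.exists_measurable_map_eq_volume
  obtain ⟨f, hf, hfm⟩ := μ.meas.exists_measurable_map_eq
  rw [measure_univ, one_smul] at hUm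
  have h1 : P.map (f ∘ U) = μ.meas := by rw [← Measure.map_map hf hU, hUm, hfm]
  exact ⟨_, law_toLp (P2.memLp_of_map_eq (hf.comp hU) h1) h1⟩

theorem norm_sq_eq_moment (X : Lp (E d) 2 P) : ‖X‖ ^ 2 = (law P X).moment := by
  rw [norm_sq_eq_integral]
  exact (integral_map (f := fun x : E d => ‖x‖ ^ 2) (measurable_Lp X).aemeasurable
    (by fun_prop)).symm

theorem norm_eq_of_law_eq {ν : P2 d} {Y : Lp (E d) 2 P} (h : law P Y = ν) :
    ‖Y‖ = √ν.moment := by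
  rw [← h, ← norm_sq_eq_moment, Real.sqrt_sq (norm_nonneg _)]

theorem map_prodMk_mem_couplings {μ ν : P2 d} {X Y : Lp (E d) 2 P} (hX : law P X = μ)
    (hY : law P Y = ν) : P.map (fun ω => (X ω, Y ω)) ∈ couplings μ ν := by
  have h : Measurable fun ω => (X ω, Y ω) := (measurable_Lp X).prodMk (measurable_Lp Y)
  subst hX hY
  constructor
  · rw [Measure.map_map measurable_fst h]
    rfl
  · rw [Measure.map_map measurable_snd h]
    rfl

/-- Perturbing the first variable by `ε` changes the correlation by at most `ε` times the first
absolute moment of the second variable. -/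
theorem abs_integral_inner_sub_le {A : Type*} [MeasurableSpace A] {Q : Measure A}
    {X X' V : A → E d} (hXm : Measurable X) (hX'm : Measurable X') (hVm : Measurable V)
    (hXV : Integrable (fun a => inner ℝ (X a) (V a)) Q) (hV : Integrable (fun a => ‖V a‖) Q)
    {ε : ℝ} (h : ∀ a, dist (X a) (X' a) ≤ ε) :
    |∫ a, inner ℝ (X' a) (V a) ∂Q - ∫ a, inner ℝ (X a) (V a) ∂Q| ≤ ε * ∫ a, ‖V a‖ ∂Q := by
  have hb : ∀ a, ‖inner ℝ (X' a - X a) (V a)‖ ≤ ε * ‖V a‖ := fun a =>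
    (norm_inner_le_norm _ _).trans (mul_le_mul_of_nonneg_right
      (by rw [← dist_eq_norm, dist_comm]; exact h a) (norm_nonneg _))
  have hi : Integrable (fun a => inner ℝ (X' a - X a) (V a)) Q :=
    (hV.const_mul ε).mono' ((hX'm.sub hXm).inner hVm).aestronglyMeasurable (ae_of_all _ hb)
  have h1 : ∫ a, inner ℝ (X' a) (V a) ∂Q
      = ∫ a, inner ℝ (X a) (V a) ∂Q + ∫ a, inner ℝ (X' a - X a) (V a) ∂Q := by
    rw [← integral_add hXV hi]
    refine integral_congr_ae (ae_of_all _ fun a => ?_)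
    simp only [inner_sub_left]
    ring
  rw [h1, add_sub_cancel_left, ← integral_const_mul]
  exact norm_integral_le_of_norm_le (hV.const_mul ε) (ae_of_all _ hb)

/-- A joint law `ρ` of `(X, Y₁, Y₂)` is realised on an atomless space with a prescribed `X`, up to a
small error in the correlations and without error in the distance between `Y₁` and `Y₂`. -/
theorem Atomless.exists_pair (hP : Atomless P) {μ ν : P2 d} {X : Lp (E d) 2 P}
    (hX : law P X = μ) (ρ : Measure (E d × (E d × E d)))
    (h1 : ρ.map (fun p => (p.1, p.2.1)) ∈ couplings μ ν)
    (h2 : ρ.map (fun p => (p.1, p.2.2)) ∈ couplings μ ν) {ε : ℝ} (hε : 0 < ε) :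
    ∃ Y₁ Y₂ : Lp (E d) 2 P, law P Y₁ = ν ∧ law P Y₂ = ν ∧
      |inner ℝ X Y₁ - ∫ p, inner ℝ p.1 p.2.1 ∂ρ| ≤ ε ∧
      |inner ℝ X Y₂ - ∫ p, inner ℝ p.1 p.2.2 ∂ρ| ≤ ε ∧
      ‖Y₁ - Y₂‖ ^ 2 = ∫ p, ‖p.2.1 - p.2.2‖ ^ 2 ∂ρ := by
  have hXm := measurable_Lp X
  have hf1 : ρ.map Prod.fst = μ.meas := by
    have := h1.1
    rwa [Measure.map_map measurable_fst (by fun_prop)] at this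
  have hρ : IsProbabilityMeasure ρ := isProbabilityMeasure_of_map measurable_fst hf1
  have hPX : P.map X = μ.meas := congrArg Subtype.val hX
  set M : ℝ := ∫ y, ‖y‖ ∂ν.meas with hM
  have hM0 : 0 ≤ M := integral_nonneg fun _ => norm_nonneg _
  -- The first variable is discretised once on `Ω` and once under `ρ`, each at a cost of at most `ε
  -- / 2`; between the two the laws agree. `V` has exactly the law of the last two variables, so
  -- their distance carries no error.
  obtain ⟨c, hc, hcX, V, hV, hVm⟩ := hP.exists_map_prodMk_eq_approx hXm ρ (hf1.trans hPX.symm)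
    (ε := ε / (2 * (M + 1))) (by positivity)
  have hcρ : Measurable (Prod.map c (id : E d × E d → E d × E d)) := hc.prodMap measurable_id
  have hcV : Measurable fun ω => (c (X ω), V ω) := (hc.comp hXm).prodMk hV
  have hVlaw : P.map V = ρ.map Prod.snd := by
    have := congrArg (Measure.map Prod.snd) hVm
    rw [Measure.map_map measurable_snd hcV, Measure.map_map measurable_snd hcρ] at this
    exact this
  have key : ∀ s : E d × E d → E d, Measurable s →
      ρ.map (fun p => (p.1, s p.2)) ∈ couplings μ ν → P.map (s ∘ V) = ν.meas ∧
      ∀ hL : MemLp (s ∘ V) 2 P,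
        |inner ℝ X (hL.toLp (s ∘ V)) - ∫ p, inner ℝ p.1 (s p.2) ∂ρ| ≤ ε := by
    intro s hs hsρ
    have hps : Measurable fun p : E d × (E d × E d) => (p.1, s p.2) := by fun_prop
    have hlaw : P.map (s ∘ V) = ν.meas := by
      rw [← Measure.map_map hs hV, hVlaw, Measure.map_map hs measurable_snd, ← hsρ.2,
        Measure.map_map measurable_snd hps]
      rfl
    refine ⟨hlaw, fun hL => ?_⟩
    have hsm : ρ.map (fun p => s p.2) = ν.meas := by
      rw [← hsρ.2, Measure.map_map measurable_snd hps]
      rfl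
    have hn1 : Integrable (fun ω => ‖s (V ω)‖) P ∧ ∫ ω, ‖s (V ω)‖ ∂P = M := by
      have h := ν.integrable_norm
      rw [hM, ← hlaw] at *
      exact ⟨h.comp_measurable (hs.comp hV),
        (integral_map (hs.comp hV).aemeasurable (by fun_prop)).symm⟩
    have hn2 : Integrable (fun p => ‖s p.2‖) ρ ∧ ∫ p, ‖s p.2‖ ∂ρ = M := by
      have h := ν.integrable_norm
      rw [hM, ← hsm] at *
      exact ⟨h.comp_measurable (hs.comp measurable_snd),
        (integral_map (hs.comp measurable_snd).aemeasurable (by fun_prop)).symm⟩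
    have hi1 : Integrable (fun ω => inner ℝ (X ω) (s (V ω))) P := by
      refine (L2.integrable_inner (𝕜 := ℝ) X (hL.toLp (s ∘ V))).congr ?_
      filter_upwards [hL.coeFn_toLp] with ω hω
      rw [hω]
      rfl
    have hi2 : Integrable (fun p : E d × (E d × E d) => inner ℝ p.1 (s p.2)) ρ :=
      (integrable_corr hsρ).comp_measurable hps
    have he1 := abs_integral_inner_sub_le hXm (hc.comp hXm) (hs.comp hV) hi1 hn1.1
      fun ω => hcX (X ω)
    have he2 := abs_integral_inner_sub_le (X := fun p : E d × (E d × E d) => p.1) measurable_fst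
      (hc.comp measurable_fst) (hs.comp measurable_snd) hi2 hn2.1 fun p => hcX p.1
    have heq : ∫ ω, inner ℝ (c (X ω)) (s (V ω)) ∂P = ∫ p, inner ℝ (c p.1) (s p.2) ∂ρ := by
      have h3 : AEStronglyMeasurable (fun p : E d × (E d × E d) => inner ℝ p.1 (s p.2))
          (P.map fun ω => (c (X ω), V ω)) := by
        exact (measurable_fst.inner (hs.comp measurable_snd)).aestronglyMeasurable
      have h4 := integral_map hcV.aemeasurable h3
      rw [hVm] at h3
      rw [← h4, hVm, integral_map hcρ.aemeasurable h3]
      rfl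
    have hin : inner ℝ X (hL.toLp (s ∘ V)) = ∫ ω, inner ℝ (X ω) (s (V ω)) ∂P := by
      rw [L2.inner_def]
      refine integral_congr_ae ?_
      filter_upwards [hL.coeFn_toLp] with ω hω
      rw [hω]
      rfl
    simp only [Function.comp_def] at he1 he2
    rw [hn1.2, heq] at he1
    rw [hn2.2] at he2
    have hεM : ε / (2 * (M + 1)) * M ≤ ε / 2 := by
      rw [div_mul_eq_mul_div, div_le_div_iff₀ (by positivity) two_pos]
      nlinarith
    rw [hin]
    rw [abs_le] at he1 he2 ⊢
    constructor <;> linarith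
  obtain ⟨hl1, hk1⟩ := key Prod.fst measurable_fst h1
  obtain ⟨hl2, hk2⟩ := key Prod.snd measurable_snd h2
  have hL1 := P2.memLp_of_map_eq (measurable_fst.comp hV) hl1
  have hL2 := P2.memLp_of_map_eq (measurable_snd.comp hV) hl2
  refine ⟨hL1.toLp _, hL2.toLp _, law_toLp hL1 hl1, law_toLp hL2 hl2, hk1 hL1, hk2 hL2, ?_⟩
  rw [← MemLp.toLp_sub, norm_sq_eq_integral]
  have h3 : ∫ ω, ‖(hL1.sub hL2).toLp _ ω‖ ^ 2 ∂P = ∫ ω, ‖(V ω).1 - (V ω).2‖ ^ 2 ∂P := by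
    refine integral_congr_ae ?_
    filter_upwards [(hL1.sub hL2).coeFn_toLp] with ω hω
    rw [hω]
    rfl
  rw [h3]
  have hm : Measurable fun q : E d × E d => ‖q.1 - q.2‖ ^ 2 := by fun_prop
  rw [← integral_map (φ := V) (f := fun q : E d × E d => ‖q.1 - q.2‖ ^ 2) hV.aemeasurable
    hm.aestronglyMeasurable, hVlaw, integral_map measurable_snd.aemeasurable
    hm.aestronglyMeasurable]

/-- On an atomless space, the maximal correlation with `ν` is the support function of the set of
random vectors of law `ν`. -/
theorem Atomless.isSupportFunction (hP : Atomless P) (ν : P2 d) :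
    IsSupportFunction {Y : Lp (E d) 2 P | law P Y = ν} fun Z => maxCorr (law P Z) ν := by
  intro Z
  constructor
  · rintro _ ⟨Y, hY, rfl⟩
    simp only
    rw [inner_eq_integral_map]
    exact integral_corr_le (map_prodMk_mem_couplings rfl hY)
  · intro b hb
    refine le_of_forall_pos_le_add fun ε hε => ?_
    obtain ⟨π, hπ, hπm⟩ := exists_integral_corr_eq (law P Z) ν
    -- Only one `Y` is needed, so the second variable is duplicated.
    have hm : Measurable fun z : E d × E d => (z.1, (z.2, z.2)) := by fun_prop
    have h1 : (π.map fun z => (z.1, (z.2, z.2))).map (fun p => (p.1, p.2.1)) = π := by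
      rw [Measure.map_map (by fun_prop) hm]
      exact Measure.map_id
    have h2 : (π.map fun z => (z.1, (z.2, z.2))).map (fun p => (p.1, p.2.2)) = π := by
      rw [Measure.map_map (by fun_prop) hm]
      exact Measure.map_id
    obtain ⟨Y, -, hY, -, h3, -⟩ := hP.exists_pair (X := Z) rfl _ (h1.symm ▸ hπ) (h2.symm ▸ hπ) hε
    rw [integral_map hm.aemeasurable (by fun_prop), hπm] at h3
    have h4 : inner ℝ Z Y ≤ b := hb (mem_image_of_mem _ hY)
    simp only
    linarith [(abs_le.1 h3).1]

theorem lift_W2sq_eq (ν : P2 d) (Z : Lp (E d) 2 P) :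
    lift P (fun σ => W2sq σ ν) Z = ‖Z‖ ^ 2 + ν.moment - 2 * maxCorr (law P Z) ν := by
  rw [lift, W2sq_eq, norm_sq_eq_moment]

/-- Kantorovich duality: the dual formulation yields the squared Wasserstein distance. -/
theorem WW2sq_eq (Z Y : Lp (E d) 2 P) : WW2sq P Z Y = W2sq (law P Z) (law P Y) := by
  set μ := law P Z
  set ν := law P Y
  have hμ := μ.integrable_sq
  have hν := ν.integrable_sq
  have hsplit : ∀ ψ ψ' : E d → ℝ, Integrable ψ μ.meas → Integrable ψ' ν.meas →
      ∫ ω, (ψ (Z ω) + ψ' (Y ω)) ∂P = ∫ x, ψ x ∂μ.meas + ∫ y, ψ' y ∂ν.meas := by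
    intro ψ ψ' hψ hψ'
    refine (integral_add (hψ.comp_measurable (measurable_Lp Z))
      (hψ'.comp_measurable (measurable_Lp Y))).trans ?_
    congr 1
    · exact (integral_map (measurable_Lp Z).aemeasurable hψ.1).symm
    · exact (integral_map (measurable_Lp Y).aemeasurable hψ'.1).symm
  -- The substitution `ψ = ‖·‖ ^ 2 - 2 * φ` exchanges dual pairs for the cost with dual pairs for
  -- the correlation; `hhalf` is its inverse.
  have hconv : ∀ (m : P2 d) (φ : E d → ℝ), Integrable φ m.meas →
      Integrable (fun x => ‖x‖ ^ 2 - 2 * φ x) m.meas ∧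
      ∫ x, (‖x‖ ^ 2 - 2 * φ x) ∂m.meas = m.moment - 2 * ∫ x, φ x ∂m.meas := by
    intro m φ hφ
    refine ⟨m.integrable_sq.sub (hφ.const_mul 2), ?_⟩
    rw [integral_sub m.integrable_sq (hφ.const_mul 2), integral_const_mul]
    rfl
  have hmem : ∀ φ φ' : E d → ℝ, Integrable φ μ.meas → Integrable φ' ν.meas →
      (∀ x y, (corr d).1 (x, y) ≤ φ x + φ' y) →
      μ.moment + ν.moment - 2 * (∫ x, φ x ∂μ.meas + ∫ y, φ' y ∂ν.meas) ∈ dualValues P Z Y := by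
    intro φ φ' hφ hφ' h
    refine ⟨_, _, (hconv μ φ hφ).1, (hconv ν φ' hφ').1, fun x y => ?_, ?_⟩
    · have h1 : inner ℝ x y ≤ φ x + φ' y := h x y
      rw [norm_sub_sq_eq_sub]
      linarith
    · rw [hsplit _ _ (hconv μ φ hφ).1 (hconv ν φ' hφ').1, (hconv μ φ hφ).2, (hconv ν φ' hφ').2]
      ring
  have hlub : IsLUB (dualValues P Z Y) (W2sq μ ν) := by
    rw [W2sq_eq]
    constructor
    · rintro r ⟨ψ, ψ', hψ, hψ', h, rfl⟩
      have hhalf : ∀ (m : P2 d) (φ : E d → ℝ), Integrable φ m.meas →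
          Integrable (fun x => (‖x‖ ^ 2 - φ x) / 2) m.meas ∧
          ∫ x, (‖x‖ ^ 2 - φ x) / 2 ∂m.meas = (m.moment - ∫ x, φ x ∂m.meas) / 2 := by
        intro m φ hφ
        refine ⟨(m.integrable_sq.sub hφ).div_const 2, ?_⟩
        rw [integral_div, integral_sub m.integrable_sq hφ]
        rfl
      have h1 := dualInf_le hμ hν (f := corr d) (hhalf μ ψ hψ).1 (hhalf ν ψ' hψ').1 fun x y => by
        have h2 := h x y
        rw [norm_sub_sq_eq_sub] at h2
        change inner ℝ x y ≤ _
        linarith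
      rw [(hhalf μ ψ hψ).2, (hhalf ν ψ' hψ').2] at h1
      rw [hsplit ψ ψ' hψ hψ', maxCorr]
      linarith
    · intro b hb
      have h1 : (μ.moment + ν.moment - b) / 2 ≤ maxCorr μ ν := by
        refine le_dualInf hμ hν fun φ φ' hφ hφ' h => ?_
        have := hb (hmem φ φ' hφ hφ' h)
        linarith
      linarith
  obtain ⟨φ, φ', hφ, hφ', h⟩ := quadGrowth.exists_le hμ hν (corr d)
  exact hlub.csSup_eq ⟨_, hmem φ φ' hφ hφ' fun x y => (le_abs_self _).trans (h x y)⟩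

end Law

/-! ### Gluing couplings along a common marginal. -/

section Gluing

open ProbabilityTheory

variable {d : ℕ}

/-- Two couplings with the same first marginal can be glued along it. -/
noncomputable def glue (π π' : Measure (E d × E d)) [IsFiniteMeasure π] [IsFiniteMeasure π'] :
    Measure (E d × (E d × E d)) :=
  π.fst ⊗ₘ (π.condKernel ×ₖ π'.condKernel)

variable {π π' : Measure (E d × E d)} [IsFiniteMeasure π] [IsFiniteMeasure π']

theorem map_glue_fst : (glue π π').map (fun p => (p.1, p.2.1)) = π := by
  have h : π.fst ⊗ₘ (π.condKernel ×ₖ π'.condKernel).fst = π := by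
    rw [Kernel.fst_prod, π.disintegrate]
  rw [Kernel.fst_eq, Measure.compProd_map measurable_fst] at h
  exact h

theorem map_glue_snd (h : π.fst = π'.fst) : (glue π π').map (fun p => (p.1, p.2.2)) = π' := by
  have h1 : π.fst ⊗ₘ (π.condKernel ×ₖ π'.condKernel).snd = π' := by
    rw [Kernel.snd_prod, h, π'.disintegrate]
  rw [Kernel.snd_eq, Measure.compProd_map measurable_snd] at h1
  exact h1

theorem eq_of_glue_ae_eq (h : π.fst = π'.fst) (hg : ∀ᵐ p ∂(glue π π'), p.2.1 = p.2.2) :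
    π = π' := by
  rw [← map_glue_snd h]
  conv_lhs => rw [← map_glue_fst (π := π) (π' := π')]
  refine Measure.map_congr ?_
  filter_upwards [hg] with p hp
  rw [hp]

/-- If gluing a coupling to itself identifies the second variables, then the coupling is carried by
a graph. -/
theorem exists_map_eq_of_glue_self_ae_eq (hg : ∀ᵐ p ∂(glue π π), p.2.1 = p.2.2) :
    ∃ T : E d → E d, Measurable T ∧ π = π.fst.map fun x => (x, T x) := by
  -- The square of almost every conditional law charges only the diagonal, so that law is a Dirac
  -- mass; its barycentre selects the atom measurably.
  let T : E d → E d := fun x => ∫ y, y ∂(π.condKernel x)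
  have hT : Measurable T := (stronglyMeasurable_id.integral_kernel).measurable
  refine ⟨T, hT, ?_⟩
  have h1 : ∀ᵐ x ∂π.fst, ∀ᵐ y ∂(π.condKernel x), y = T x := by
    filter_upwards [Measure.ae_ae_of_ae_compProd hg] with x hx
    rw [Kernel.prod_apply] at hx
    filter_upwards [Measure.ae_ae_of_ae_prod hx] with y hy
    have h2 : T x = ∫ _, y ∂(π.condKernel x) := integral_congr_ae (hy.mono fun _ h => h.symm)
    rw [h2, integral_const, probReal_univ, one_smul]
  have h2 : ∀ᵐ z ∂π, z.2 = T z.1 := by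
    have h3 := Measure.ae_compProd_of_ae_ae (κ := π.condKernel)
      (measurableSet_eq_fun measurable_snd (hT.comp measurable_fst)) h1
    rwa [π.disintegrate] at h3
  have h3 : π.map (fun z => (z.1, T z.1)) = π.map id := by
    refine Measure.map_congr ?_
    filter_upwards [h2] with z hz
    rw [← hz]
    rfl
  rw [Measure.map_id] at h3
  conv_lhs => rw [← h3]
  rw [Measure.fst, Measure.map_map (measurable_id'.prodMk hT) measurable_fst]
  rfl

end Gluing

/-! ### The two implications and the gradient. -/

section Main

variable {Ω : Type*} [MeasurableSpace Ω] {P : Measure Ω} [IsProbabilityMeasure P] {d : ℕ}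

theorem hasGradientAt_lift {ν : P2 d} {X D : Lp (E d) 2 P}
    (h : HasGradientAt (fun Z => maxCorr (law P Z) ν) D X) :
    HasGradientAt (lift P fun σ => W2sq σ ν) ((2 : ℝ) • (X - D)) X := by
  rw [hasGradientAt_iff_hasFDerivAt] at h ⊢
  have h1 := (((hasStrictFDerivAt_norm_sq X).hasFDerivAt).add_const ν.moment).sub (h.const_mul 2)
  have h2 : lift P (fun σ => W2sq σ ν)
      = fun Z => ‖Z‖ ^ 2 + ν.moment - 2 * maxCorr (law P Z) ν := funext (lift_W2sq_eq ν)
  rw [h2]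
  refine h1.congr_fderiv ?_
  ext Z
  simp
  ring

theorem exists_hasGradientAt_maxCorr {ν : P2 d} {X : Lp (E d) 2 P}
    (h : DifferentiableAt ℝ (lift P fun σ => W2sq σ ν) X) :
    ∃ D, HasGradientAt (fun Z : Lp (E d) 2 P => maxCorr (law P Z) ν) D X := by
  have h1 : (fun Z : Lp (E d) 2 P => maxCorr (law P Z) ν)
      = fun Z => (2 : ℝ)⁻¹ * (‖Z‖ ^ 2 + ν.moment - lift P (fun σ => W2sq σ ν) Z) := by
    ext Z
    rw [lift_W2sq_eq]
    ring
  rw [h1]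
  have h2 := (((hasStrictFDerivAt_norm_sq X).differentiableAt.add_const ν.moment).sub h).const_mul
    (2 : ℝ)⁻¹
  exact ⟨_, h2.hasGradientAt⟩

/-- If the maximal correlation is differentiable at `X`, then gluing two optimal couplings
identifies the second variables. -/
theorem Atomless.glue_ae_eq (hP : Atomless P) {μ ν : P2 d} {X D : Lp (E d) 2 P} (hX : law P X = μ)
    (hD : HasGradientAt (fun Z => maxCorr (law P Z) ν) D X) {π π' : Measure (E d × E d)}
    [IsFiniteMeasure π] [IsFiniteMeasure π']
    (hπ : π ∈ optCouplings μ ν) (hπ' : π' ∈ optCouplings μ ν) :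
    ∀ᵐ p ∂(glue π π'), p.2.1 = p.2.2 := by
  obtain ⟨hc, hm⟩ := mem_optCouplings_iff.1 hπ
  obtain ⟨hc', hm'⟩ := mem_optCouplings_iff.1 hπ'
  have hfst : π.fst = π'.fst := hc.1.trans hc'.1.symm
  have h1 := map_glue_fst (π := π) (π' := π')
  have h2 := map_glue_snd hfst
  have hm1 : ∫ p, inner ℝ p.1 p.2.1 ∂(glue π π') = maxCorr μ ν := by
    rw [← hm]
    conv_rhs => rw [← h1]
    rw [integral_map (by fun_prop) (by fun_prop)]
  have hm2 : ∫ p, inner ℝ p.1 p.2.2 ∂(glue π π') = maxCorr μ ν := by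
    rw [← hm']
    conv_rhs => rw [← h2]
    rw [integral_map (by fun_prop) (by fun_prop)]
  -- The glued measure is realised with correlation error `η / 2`, so `Y₁` and `Y₂` are
  -- `η`-maximizers and lie within `δ` of `D`, while `‖Y₁ - Y₂‖ ^ 2` is exactly this integral.
  have hle : ∀ δ > 0, ∫ p, ‖p.2.1 - p.2.2‖ ^ 2 ∂(glue π π') ≤ (2 * δ) ^ 2 := by
    intro δ hδ
    obtain ⟨η, hη, hS⟩ := (hP.isSupportFunction ν).norm_sub_le_of_hasGradientAt hD hδ
    obtain ⟨Y₁, Y₂, hY₁, hY₂, hi1, hi2, heq⟩ := hP.exists_pair hX (glue π π')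
      (h1.symm ▸ hc) (h2.symm ▸ hc') (half_pos hη)
    rw [← heq]
    have hd1 := hS Y₁ hY₁ (by
      rw [hX]
      linarith [(abs_le.1 hi1).1])
    have hd2 := hS Y₂ hY₂ (by
      rw [hX]
      linarith [(abs_le.1 hi2).1])
    refine pow_le_pow_left₀ (norm_nonneg _) ?_ 2
    have h3 := norm_sub_le_norm_sub_add_norm_sub Y₁ D Y₂
    rw [norm_sub_rev D Y₂] at h3
    linarith
  have hint : Integrable (fun p : E d × (E d × E d) => ‖p.2.1 - p.2.2‖ ^ 2) (glue π π') := by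
    have hi1 : Integrable (fun p : E d × (E d × E d) => ‖p.2.1‖ ^ 2) (glue π π') := by
      have h3 := (integral_snd hc.2 ν.integrable_sq).1
      rw [← h1] at h3
      exact h3.comp_measurable (by fun_prop)
    have hi2 : Integrable (fun p : E d × (E d × E d) => ‖p.2.2‖ ^ 2) (glue π π') := by
      have h3 := (integral_snd hc'.2 ν.integrable_sq).1
      rw [← h2] at h3
      exact h3.comp_measurable (by fun_prop)
    refine ((hi1.const_mul 2).add (hi2.const_mul 2)).mono' (by fun_prop) (ae_of_all _ fun p => ?_)
    rw [Real.norm_of_nonneg (sq_nonneg _)]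
    simp only [Pi.add_apply]
    nlinarith [norm_sub_le p.2.1 p.2.2, norm_nonneg (p.2.1 - p.2.2), norm_nonneg p.2.1,
      norm_nonneg p.2.2, sq_nonneg (‖p.2.1‖ - ‖p.2.2‖)]
  have h0 : ∫ p, ‖p.2.1 - p.2.2‖ ^ 2 ∂(glue π π') = 0 := by
    refine le_antisymm (le_of_forall_pos_le_add fun ε hε => ?_)
      (integral_nonneg fun p => sq_nonneg _)
    have h3 := hle (√ε / 2) (by positivity)
    rwa [mul_div_cancel₀ _ two_ne_zero, Real.sq_sqrt hε.le, ← zero_add ε] at h3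
  rw [integral_eq_zero_iff_of_nonneg (fun p => sq_nonneg _) hint] at h0
  filter_upwards [h0] with p hp
  simpa [sub_eq_zero] using hp

theorem Atomless.exists_optCouplings_eq (hP : Atomless P) {μ ν : P2 d}
    (h : LDifferentiableAt P (fun σ : P2 d => W2sq σ ν) μ) :
    ∃ T : E d → E d, Measurable T ∧ optCouplings μ ν = {μ.meas.map (fun x => (x, T x))} := by
  obtain ⟨X, hX, hdiff⟩ := h
  obtain ⟨D, hD⟩ := exists_hasGradientAt_maxCorr hdiff
  obtain ⟨π, hc, hm⟩ := exists_integral_corr_eq μ ν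
  have hπ : π ∈ optCouplings μ ν := mem_optCouplings_iff.2 ⟨hc, hm⟩
  have : IsProbabilityMeasure π := isProbabilityMeasure_of_map measurable_fst hc.1
  obtain ⟨T, hT, hπT⟩ := exists_map_eq_of_glue_self_ae_eq (hP.glue_ae_eq hX hD hπ hπ)
  have hfst : π.fst = μ.meas := hc.1
  rw [hfst] at hπT
  refine ⟨T, hT, ?_⟩
  rw [← hπT]
  refine Subset.antisymm (fun π' hπ' => ?_) (singleton_subset_iff.2 hπ)
  have : IsProbabilityMeasure π' := isProbabilityMeasure_of_map measurable_fst hπ'.1.1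
  exact (eq_of_glue_ae_eq (hc.1.trans hπ'.1.1.symm) (hP.glue_ae_eq hX hD hπ hπ')).symm

theorem norm_sub_sq_le_two_mul {G : Type*} [SeminormedAddCommGroup G] (x y z : G) :
    ‖x - z‖ ^ 2 ≤ 2 * ‖x - y‖ ^ 2 + 2 * ‖y - z‖ ^ 2 := by
  have h := norm_sub_le_norm_sub_add_norm_sub x y z
  nlinarith [norm_nonneg (x - z), sq_nonneg (‖x - y‖ - ‖y - z‖)]

/-- If the optimal coupling of `μ` and `ν` is unique and given by a map `T`, then random vectors of
law `ν` which are almost maximally correlated with `X` are close to `T(X)`. -/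
theorem exists_norm_sub_le {μ ν : P2 d} {T : E d → E d} (hT : Measurable T)
    (hopt : optCouplings μ ν = {μ.meas.map (fun x => (x, T x))}) {X D : Lp (E d) 2 P}
    (hX : law P X = μ) (hD : D =ᵐ[P] fun ω => T (X ω)) {δ : ℝ} (hδ : 0 < δ) :
    ∃ η > 0, ∀ Y : Lp (E d) 2 P, law P Y = ν → maxCorr μ ν - η < inner ℝ X Y → ‖Y - D‖ ≤ δ := by
  have hXm := measurable_Lp X
  have hPX : P.map X = μ.meas := congrArg Subtype.val hX
  have hgr : Measurable fun x => (x, T x) := measurable_id.prodMk hT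
  have hmem : μ.meas.map (fun x => (x, T x)) ∈ optCouplings μ ν := hopt ▸ mem_singleton _
  have hTlaw : μ.meas.map T = ν.meas := by
    rw [← hmem.1.2, Measure.map_map measurable_snd hgr]
    rfl
  have hTL : MemLp T 2 μ.meas := P2.memLp_of_map_eq hT hTlaw
  -- Duality needs a continuous reward of quadratic growth, so `T` is replaced by a bounded
  -- continuous `S` close to it in L²(μ). Under the unique optimal coupling the integral of `g` is
  -- the integral of `‖T - S‖ ^ 2`.
  obtain ⟨S, hS, hSL⟩ := MemLp.exists_boundedContinuous_integral_rpow_sub_le (p := 2) two_pos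
    (f := T) (by simpa using hTL) (ε := δ ^ 2 / 16) (by positivity)
  simp only [Real.rpow_two] at hS
  obtain ⟨C, hC⟩ : ∃ C, ∀ x, ‖S x‖ ≤ C := ⟨‖S‖, S.norm_coe_le_norm⟩
  let g : quadGrowth (E d) := ⟨fun z => ‖z.2 - S z.1‖ ^ 2, 2 + 2 * C ^ 2, fun z => by
    have h1 := hC z.1
    have h2 := norm_sub_le z.2 (S z.1)
    have h3 := pow_le_pow_left₀ (norm_nonneg _) h1 2
    rw [abs_of_nonneg (sq_nonneg _)]
    nlinarith [norm_nonneg (z.2 - S z.1), sq_nonneg (‖z.2‖ - ‖S z.1‖), sq_nonneg ‖z.1‖,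
      sq_nonneg ‖z.2‖, sq_nonneg C, mul_nonneg (sq_nonneg C) (sq_nonneg ‖z.1‖),
      mul_nonneg (sq_nonneg C) (sq_nonneg ‖z.2‖)]⟩
  have hSc : Continuous S := S.continuous
  have hg : Continuous g.1 := by
    change Continuous fun z : E d × E d => ‖z.2 - S z.1‖ ^ 2
    fun_prop
  obtain ⟨t, ht, hgap⟩ := exists_integral_le_add_gap μ.integrable_sq ν.integrable_sq (corr d) g
    continuous_corr hg (b := δ ^ 2 / 16) (fun π h1 h2 h3 => by
      have h4 : π ∈ optCouplings μ ν := mem_optCouplings_iff.2 ⟨⟨h1, h2⟩, h3⟩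
      rw [hopt, mem_singleton_iff] at h4
      rw [h4, integral_map hgr.aemeasurable hg.aestronglyMeasurable]
      exact hS) (ε := δ ^ 2 / 8) (by positivity)
  -- This keeps `t` times the gap below `δ ^ 2 / 8`, also when `t = 0`. In total `2 * (1/16 + 1/8 +
  -- 1/8) + 2 * (1/16) = 3/4`, so `‖Y - D‖ ^ 2` is at most `3/4 * δ ^ 2`.
  refine ⟨δ ^ 2 / (8 * (t + 1)), by positivity, fun Y hY hXY => ?_⟩
  have hcpl := map_prodMk_mem_couplings hX hY
  have hXYm : Measurable fun ω => (X ω, Y ω) := hXm.prodMk (measurable_Lp Y)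
  have h1 := hgap _ hcpl.1 hcpl.2
  have hcorr : ∫ z, (corr d).1 z ∂(P.map fun ω => (X ω, Y ω)) = inner ℝ X Y :=
    (inner_eq_integral_map X Y).symm
  have hgi : Integrable g.1 (P.map fun ω => (X ω, Y ω)) :=
    integrable_of_mem_quadGrowth hcpl.1 hcpl.2 μ.integrable_sq ν.integrable_sq g.2
      hg.aestronglyMeasurable
  rw [hcorr, integral_map hXYm.aemeasurable hg.aestronglyMeasurable] at h1
  have hi1 : Integrable (fun ω => ‖Y ω - S (X ω)‖ ^ 2) P := hgi.comp_measurable hXYm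
  have h1' : ∫ ω, ‖Y ω - S (X ω)‖ ^ 2 ∂P
      ≤ δ ^ 2 / 16 + δ ^ 2 / 8 + t * (maxCorr μ ν - inner ℝ X Y) := h1
  have hi2 : Integrable (fun x => ‖T x - S x‖ ^ 2) μ.meas :=
    (memLp_two_iff_integrable_sq_norm (hTL.1.sub hSc.aestronglyMeasurable)).1
      (hTL.sub (by simpa using hSL))
  have hi3 : Integrable (fun ω => ‖S (X ω) - T (X ω)‖ ^ 2) P := by
    simp_rw [norm_sub_rev (S _)]
    rw [← hPX] at hi2
    exact hi2.comp_measurable hXm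
  have h3 : ∫ ω, ‖S (X ω) - T (X ω)‖ ^ 2 ∂P ≤ δ ^ 2 / 16 := by
    simp_rw [norm_sub_rev (S _)]
    rw [← hPX] at hi2 hS
    rwa [integral_map hXm.aemeasurable hi2.1] at hS
  have h4 : ‖Y - D‖ ^ 2
      ≤ 2 * ∫ ω, ‖Y ω - S (X ω)‖ ^ 2 ∂P + 2 * ∫ ω, ‖S (X ω) - T (X ω)‖ ^ 2 ∂P := by
    rw [norm_sq_eq_integral, ← integral_const_mul, ← integral_const_mul,
      ← integral_add (hi1.const_mul 2) (hi3.const_mul 2)]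
    refine integral_mono_of_nonneg (ae_of_all _ fun ω => sq_nonneg _)
      ((hi1.const_mul 2).add (hi3.const_mul 2)) ?_
    filter_upwards [hD, Lp.coeFn_sub Y D] with ω h5 h6
    rw [h6, Pi.sub_apply, h5]
    exact norm_sub_sq_le_two_mul _ _ _
  have h5 : t * (maxCorr μ ν - inner ℝ X Y) ≤ δ ^ 2 / 8 := by
    have h6 : maxCorr μ ν - inner ℝ X Y ≤ δ ^ 2 / (8 * (t + 1)) := by linarith
    refine (mul_le_mul_of_nonneg_left h6 ht).trans ?_
    rw [mul_div_assoc', div_le_div_iff₀ (by positivity) (by norm_num)]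
    nlinarith [sq_nonneg δ]
  refine le_of_sq_le_sq ?_ hδ.le
  nlinarith [sq_nonneg δ]

/-- If the optimal coupling of `μ` and `ν` is unique and given by a map `T`, then the maximal
correlation has gradient `T(X)` at each `X` of law `μ`. -/
theorem Atomless.exists_hasGradientAt_maxCorr (hP : Atomless P) {μ ν : P2 d} {T : E d → E d}
    (hT : Measurable T) (hopt : optCouplings μ ν = {μ.meas.map (fun x => (x, T x))})
    {X : Lp (E d) 2 P} (hX : law P X = μ) :
    ∃ D : Lp (E d) 2 P, (D =ᵐ[P] fun ω => T (X ω)) ∧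
      HasGradientAt (fun Z => maxCorr (law P Z) ν) D X := by
  have hXm := measurable_Lp X
  have hPX : P.map X = μ.meas := congrArg Subtype.val hX
  have hgr : Measurable fun x => (x, T x) := measurable_id.prodMk hT
  have hmem : μ.meas.map (fun x => (x, T x)) ∈ optCouplings μ ν := hopt ▸ mem_singleton _
  have hlaw : P.map (T ∘ X) = ν.meas := by
    rw [← Measure.map_map hT hXm, hPX, ← hmem.1.2, Measure.map_map measurable_snd hgr]
    rfl
  have hL := P2.memLp_of_map_eq (hT.comp hXm) hlaw
  have hDae : hL.toLp (T ∘ X) =ᵐ[P] fun ω => T (X ω) := hL.coeFn_toLp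
  have hDlaw := law_toLp hL hlaw
  refine ⟨hL.toLp (T ∘ X), hDae, ?_⟩
  refine (hP.isSupportFunction ν).hasGradientAt (R := √ν.moment)
    (fun Y hY => (norm_eq_of_law_eq hY).le) hDlaw ?_ fun δ hδ => ?_
  · have h1 : P.map (fun ω => (X ω, hL.toLp (T ∘ X) ω)) = μ.meas.map fun x => (x, T x) := by
      rw [← hPX, Measure.map_map hgr hXm]
      refine Measure.map_congr ?_
      filter_upwards [hDae] with ω hω
      rw [hω]
      rfl
    rw [inner_eq_integral_map, h1, hX]
    exact (mem_optCouplings_iff.1 hmem).2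
  · simp only [hX]
    exact exists_norm_sub_le hT hopt hX hDae hδ

end Main

end LionsW2

open LionsW2
theorem theorem2 {d : ℕ} {Ω : Type*} [MeasurableSpace Ω] (P : Measure Ω) [IsProbabilityMeasure P]
    (hP : Atomless P) (μ ν : P2 d) :
    (LDifferentiableAt P (fun σ : P2 d => W2sq σ ν) μ ↔
      ∃ T : E d → E d, Measurable T ∧ optCouplings μ ν = {μ.meas.map (fun x => (x, T x))}) ∧
    (∀ T : E d → E d, Measurable T → optCouplings μ ν = {μ.meas.map (fun x => (x, T x))} →
      ∀ X Y : Lp (E d) 2 P, law P X = μ → law P Y = ν →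
        ∃ G : Lp (E d) 2 P, (∀ᵐ ω ∂P, G ω = (2 : ℝ) • (X ω - T (X ω))) ∧
          HasGradientAt (lift P (fun σ : P2 d => W2sq σ ν)) G X ∧
          HasGradientAt (fun Z : Lp (E d) 2 P => WW2sq P Z Y) G X) := by
  refine ⟨⟨hP.exists_optCouplings_eq, ?_⟩, ?_⟩
  · rintro ⟨T, hT, hopt⟩
    obtain ⟨X, hX⟩ := hP.exists_law_eq μ
    obtain ⟨D, -, hD⟩ := hP.exists_hasGradientAt_maxCorr hT hopt hX
    exact ⟨X, hX, (hasGradientAt_lift hD).differentiableAt⟩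
  · intro T hT hopt X Y hX hY
    obtain ⟨D, hDae, hD⟩ := hP.exists_hasGradientAt_maxCorr hT hopt hX
    have hlift := hasGradientAt_lift hD
    refine ⟨(2 : ℝ) • (X - D), ?_, hlift, ?_⟩
    · filter_upwards [hDae, Lp.coeFn_smul (2 : ℝ) (X - D), Lp.coeFn_sub X D] with ω h1 h2 h3
      rw [h2, Pi.smul_apply, h3, Pi.sub_apply, h1]
    · have h1 : (fun Z : Lp (E d) 2 P => WW2sq P Z Y) = lift P (fun σ : P2 d => W2sq σ ν) := by
        ext Z
        rw [WW2sq_eq, hY]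
        rfl
      rwa [h1]
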